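/- Let $X$ be an infinite discrete abelian group (written multiplicatively) with a Haar measure $\alpha$, and let $\hat X$ be its compact dual group of characters, with the Haar measure $\hat\alpha$ normalized so that $f(x)=\int_{\hat X}\hat f(\gamma)\gamma(x)\,\hat\alpha(d\gamma)$ for every $x \in X$ and every integrable positive-definite function $f$ on $X$, where $\hat f(\gamma)=\int_X f(x)\gamma(x^{-1})\,\alpha(dx)$ for $f\in L^1(X)$. Let $f\mapsto\hat f$ on $L^2(X)$ denote the unique extension of the Fourier transform from $L^1(X) \cap L^2(X)$ to a linear isometry $L^2(X)\to L^2(\hat X)$. For $0<p,q\le\infty$ define $$C_{p,q}:=\sup\{\|\hat f\|_{L^q(\hat X)} : f\in L^2(X)\cap L^p(X),\ \|f\|_{L^p(X)}=1\}\in[0,\infty],$$ where $\|f\|_{L^p(X)}=(\int_X|f|^p\,d\alpha)^{1/p}$ for $0<p<\infty$ (also for $p<1$), the norm for $p=\infty$ is the essential supremum, and likewise on $\hat X$. Then for all $0<p,q\le\infty$, with $1/\infty=0$: * if $1/p+1/q\ge 1$ and $1/p\ge 1/2$, then $C_{p,q}=\hat\alpha(\hat X)^{1/p+1/q-1}$;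 * if $1/p+1/q<1$ and $1/q<1/2$, then $C_{p,q}=\infty$; * if $1/p<1/2$ and $1/q\ge 1/2$, then $C_{p,q}=\infty$. -/

import Mathlib

open MeasureTheory
open scoped ENNReal ComplexConjugate ComplexOrder

namespace LCAFourier

section
variable {X : Type*} [CommGroup X] [TopologicalSpace X]

/-- The Pontryagin dual `X̂` carries its Borel σ-algebra. -/
noncomputable instance dualMeasurableSpace : MeasurableSpace (PontryaginDual X) :=
  borel (PontryaginDual X)

instance dualBorelSpace : BorelSpace (PontryaginDual X) := ⟨rfl⟩

/-- The Fourier transform `f̂(γ) = ∫ f(x) γ(x⁻¹) dα(x)` of an integrable function `f` on `X`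
(group written multiplicatively). -/
noncomputable def fourierIntegral [MeasurableSpace X] (α : Measure X) (f : X → ℂ)
    (γ : PontryaginDual X) : ℂ :=
  ∫ x, f x * (γ x⁻¹ : ℂ) ∂α

/-- Positive-definite functions: `∑ᵢⱼ cᵢ c̄ⱼ f(xᵢ xⱼ⁻¹)` is real and nonnegative for all finite families. -/
def IsPosDefFun {X : Type*} [CommGroup X] (f : X → ℂ) : Prop :=
  ∀ (n : ℕ) (x : Fin n → X) (c : Fin n → ℂ),
    0 ≤ ∑ i, ∑ j, c i * conj (c j) * f (x i * (x j)⁻¹)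

/-- `ν` is the Haar (Radon) measure on `X̂` dual to `α`: it is normalized so that the Fourier
inversion formula holds for every integrable positive-definite function. (No continuity is asked of
`f`; the notion is used for discrete `X` only.) Existence and uniqueness of this measure for discrete
`X` are proved below. -/
structure IsDualHaar [MeasurableSpace X] (α : Measure X) (ν : Measure (PontryaginDual X)) : Prop where
  isHaar : ν.IsHaarMeasure
  regular : ν.Regular
  inversion : ∀ f : X → ℂ, IsPosDefFun f → Integrable f α →
    Integrable (fourierIntegral α f) ν ∧
      ∀ x, f x = ∫ γ, fourierIntegral α f γ * (γ x : ℂ) ∂ν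
end

section
variable {X : Type*} [CommGroup X]

theorem isPosDefFun_single : IsPosDefFun (open Classical in Pi.single (1 : X) (1 : ℂ)) := by
  classical
  intro n x c
  have h : ∀ i j, (Pi.single (1 : X) (1 : ℂ) : X → ℂ) (x i * (x j)⁻¹) =
      ∑ z ∈ Finset.univ.image x, (if x i = z then 1 else 0) * (if x j = z then 1 else 0) := by
    intro i j
    simp [Pi.single_apply, mul_inv_eq_one, eq_comm]
  have h2 : ∑ i, ∑ j, c i * conj (c j) * (Pi.single (1 : X) (1 : ℂ) : X → ℂ) (x i * (x j)⁻¹) =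
      ∑ z ∈ Finset.univ.image x, (∑ i, c i * (if x i = z then 1 else 0)) *
        conj (∑ i, c i * (if x i = z then 1 else 0)) := by
    simp_rw [h, Finset.mul_sum, map_sum, Finset.sum_mul_sum]
    rw [Finset.sum_congr rfl fun i _ => Finset.sum_comm, Finset.sum_comm]
    refine Finset.sum_congr rfl fun z _ => Finset.sum_congr rfl fun i _ =>
      Finset.sum_congr rfl fun j _ => ?_
    split_ifs <;> simp
  convert_to 0 ≤ ∑ i, ∑ j, c i * conj (c j) * (Pi.single (1 : X) (1 : ℂ) : X → ℂ) (x i * (x j)⁻¹)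
  rw [h2]
  exact Finset.sum_nonneg fun z _ => mul_star_self_nonneg _

end

section
variable {X : Type*} [CommGroup X] [TopologicalSpace X] [DiscreteTopology X]
/-- Characters separate the points of a discrete abelian group. -/
theorem exists_character_ne_one {x : X} (hx : x ≠ 1) :
    ∃ γ : PontryaginDual X, γ x ≠ 1 := by
  obtain ⟨c, hc⟩ := CharacterModule.exists_character_apply_ne_zero_of_ne_zero
    (A := Additive X) (a := Additive.ofMul x) (by simpa using hx)
  let φ : AddCircle (1 : ℚ) →+ AddCircle (1 : ℝ) :=
    QuotientAddGroup.map _ _ (Rat.castHom ℝ).toAddMonoidHom (by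
      intro r hr
      obtain ⟨n, rfl⟩ := AddSubgroup.mem_zmultiples_iff.1 hr
      exact AddSubgroup.mem_zmultiples_iff.2 ⟨n, by simp⟩)
  have hφ : ∀ a, φ a = 0 → a = 0 := by
    intro a
    induction a using QuotientAddGroup.induction_on with
    | H r =>
      intro h
      have h' : ((r : ℝ) : AddCircle (1 : ℝ)) = 0 := h
      rw [AddCircle.coe_eq_zero_iff] at h'
      obtain ⟨n, hn⟩ := h'
      refine (AddCircle.coe_eq_zero_iff (1 : ℚ)).2 ⟨n, ?_⟩
      have : (n : ℝ) = r := by simpa using hn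
      simpa using (by exact_mod_cast this : (n : ℚ) = r)
  let m : X →* Circle :=
    { toFun := fun y => AddCircle.toCircle (φ (c (Additive.ofMul y)))
      map_one' := by simp
      map_mul' := fun y z => by simp [AddCircle.toCircle_add] }
  refine ⟨(⟨m, continuous_of_discreteTopology⟩ : X →ₜ* Circle), ?_⟩
  intro h
  apply hc
  apply hφ
  apply AddCircle.injective_toCircle (T := 1) one_ne_zero
  rw [AddCircle.toCircle_zero]
  exact h

variable [MeasurableSpace X] [BorelSpace X] (α : Measure X) [α.IsHaarMeasure]

theorem discreteHaar_eq_smul_count : α = α {1} • Measure.count := by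
  ext s -
  have h1 : ∀ x : X, α {x} = α {1} := fun x => Measure.haar_singleton α x
  have key : ∀ t : Finset X, α (t : Set X) = α {1} * t.card := by
    intro t
    rw [← sum_measure_singleton]
    rw [Finset.sum_congr rfl fun x _ => h1 x, Finset.sum_const, nsmul_eq_mul, mul_comm]
  rw [Measure.smul_apply, smul_eq_mul]
  by_cases hs : s.Finite
  · obtain ⟨t, rfl⟩ := hs.exists_finset_coe
    rw [key, Measure.count_apply_finset]
  · rw [Measure.count_apply_infinite hs, ENNReal.mul_top (by
      have : 0 < α {1} := (isOpen_discrete _).measure_pos α ⟨1, rfl⟩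
      exact this.ne')]
    refine ENNReal.eq_top_of_forall_nnreal_le fun r => ?_
    have hpos : α {1} ≠ 0 := ((isOpen_discrete ({1} : Set X)).measure_pos α ⟨1, rfl⟩).ne'
    obtain ⟨n, hn⟩ := ENNReal.exists_nat_mul_gt hpos (b := r) ENNReal.coe_ne_top
    obtain ⟨t, hts, htc⟩ := Set.Infinite.exists_subset_card_eq hs n
    calc (r : ℝ≥0∞) ≤ n * α {1} := hn.le
      _ = α (t : Set X) := by rw [key, htc, mul_comm]
      _ ≤ α s := measure_mono hts

theorem integral_eq_tsum {f : X → ℂ} (hf : Integrable f α) :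
    Summable (fun x => ‖f x‖) ∧ ∫ x, f x ∂α = ∑' x, (α.real {1} : ℂ) * f x := by
  have hpos : α {1} ≠ 0 := ((isOpen_discrete ({1} : Set X)).measure_pos α ⟨1, rfl⟩).ne'
  have hfin : α {1} ≠ ∞ := (isCompact_singleton.measure_lt_top).ne
  have hsum : Summable (fun x => ‖f x‖) := by
    rw [discreteHaar_eq_smul_count α, integrable_smul_measure hpos hfin] at hf
    exact integrable_count_iff.1 hf
  refine ⟨hsum, ?_⟩
  have hc : (Function.support f).Countable := by
    have := hsum.countable_support
    simpa [Function.support] using this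
  rw [← setIntegral_eq_integral_of_forall_compl_eq_zero (s := Function.support f)
    (fun x hx => by simpa using hx), setIntegral_countable f hc hf.integrableOn]
  have h1 : ∀ x : X, α.real {x} = α.real {1} := fun x => by
    simp [Measure.real, Measure.haar_singleton α x]
  simp_rw [h1, Complex.real_smul]
  exact tsum_subtype_eq_of_support_subset (f := fun x => (α.real {1} : ℂ) * f x) (by
    intro x hx
    simp only [Function.mem_support] at hx ⊢
    intro h; simp [h] at hx)


end

section
variable {X : Type*} [CommGroup X] [TopologicalSpace X]

theorem continuous_character_eval (x : X) :
    Continuous fun γ : PontryaginDual X => (γ x : ℂ) :=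
  continuous_subtype_val.comp (continuous_eval_const (F := X →ₜ* Circle) x)
end

section
variable {X : Type*} [CommGroup X] [TopologicalSpace X]

/-- Evaluation of characters at `x⁻¹`, as a continuous function on the dual group. -/
noncomputable def evalInv (x : X) : C(PontryaginDual X, ℂ) :=
  ⟨fun γ => (γ x⁻¹ : ℂ), continuous_character_eval x⁻¹⟩

variable [DiscreteTopology X]

theorem integral_eval (ν : Measure (PontryaginDual X)) [ν.IsMulLeftInvariant] {x : X} (hx : x ≠ 1) :
    ∫ γ : PontryaginDual X, (γ x : ℂ) ∂ν = 0 := by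
  obtain ⟨γ₀, h₀⟩ := exists_character_ne_one hx
  have h := integral_mul_left_eq_self (μ := ν) (fun γ : PontryaginDual X => (γ x : ℂ)) γ₀
  have h' : ∀ γ : PontryaginDual X, (((γ₀ * γ) x : Circle) : ℂ) = (γ₀ x : ℂ) * (γ x : ℂ) :=
    fun γ => rfl
  simp_rw [h', integral_const_mul] at h
  have h2 : ((γ₀ x : ℂ) - 1) * ∫ γ : PontryaginDual X, (γ x : ℂ) ∂ν = 0 := by
    rw [sub_mul, h, one_mul, sub_self]
  rcases mul_eq_zero.1 h2 with h3 | h3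
  · exact absurd (Circle.ext (by simpa [sub_eq_zero] using h3)) h₀
  · exact h3

theorem inner_evalInv (ν : Measure (PontryaginDual X)) [IsFiniteMeasure ν] [ν.IsMulLeftInvariant]
    (x y : X) :
    inner ℂ (ContinuousMap.toLp 2 ν ℂ (evalInv x)) (ContinuousMap.toLp 2 ν ℂ (evalInv y)) =
      open Classical in if x = y then (ν.real Set.univ : ℂ) else 0 := by
  rw [ContinuousMap.inner_toLp]
  have h : ∀ γ : PontryaginDual X, evalInv y γ * conj (evalInv x γ) = (γ (x * y⁻¹) : ℂ) := by
    intro γ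
    change (γ y⁻¹ : ℂ) * conj (γ x⁻¹ : ℂ) = _
    rw [← Circle.coe_inv_eq_conj, ← map_inv, inv_inv, map_mul, Circle.coe_mul, mul_comm]
  simp_rw [h]
  split_ifs with hxy
  · subst hxy
    simp
  · exact integral_eval ν (by rwa [Ne, mul_inv_eq_one])

variable [MeasurableSpace X] [BorelSpace X] (α : Measure X) [α.IsHaarMeasure]

theorem exists_continuous_fourierIntegral {f : X → ℂ} (hf : Integrable f α) :
    ∃ F : C(PontryaginDual X, ℂ), (∀ γ, F γ = fourierIntegral α f γ) ∧
      HasSum (fun x => ((α.real {1} : ℂ) * f x) • evalInv x) F := by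
  have hn := (integral_eq_tsum α hf).1
  have hb : ∀ x : X, ‖evalInv x‖ ≤ 1 := fun x =>
    (ContinuousMap.norm_le _ zero_le_one).2 fun γ => by
      exact (Circle.norm_coe (γ x⁻¹)).le
  have hs : Summable (fun x => ((α.real {1} : ℂ) * f x) • evalInv x) := by
    refine Summable.of_norm_bounded (hn.mul_left ‖(α.real {1} : ℂ)‖) fun x => ?_
    rw [norm_smul, norm_mul]
    exact mul_le_of_le_one_right (by positivity) (hb x)
  refine ⟨_, fun γ => ?_, hs.hasSum⟩
  have hi : Integrable (fun x => f x * (γ x⁻¹ : ℂ)) α := by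
    have hm : Measurable fun x : X => (γ x⁻¹ : ℂ) := continuous_of_discreteTopology.measurable
    exact hf.mul_bdd (c := 1) hm.aestronglyMeasurable
      (Filter.Eventually.of_forall fun x => (Circle.norm_coe (γ x⁻¹)).le)
  rw [fourierIntegral, (integral_eq_tsum α hi).2]
  have := (hs.hasSum.mapL (ContinuousMap.evalCLM ℂ γ)).tsum_eq
  rw [ContinuousMap.evalCLM_apply] at this
  rw [← this]
  refine tsum_congr fun x => ?_
  simp [evalInv, mul_assoc]

theorem inner_fourier (ν : Measure (PontryaginDual X)) [IsFiniteMeasure ν] [ν.IsMulLeftInvariant]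
    (hν : α.real {1} * ν.real Set.univ = 1)
    {f : X → ℂ} (hf : Integrable f α) {F : C(PontryaginDual X, ℂ)}
    (hF : ∀ γ, F γ = fourierIntegral α f γ) (x : X) :
    inner ℂ (ContinuousMap.toLp 2 ν ℂ (evalInv x)) (ContinuousMap.toLp 2 ν ℂ F) = f x := by
  obtain ⟨G, hG, hs⟩ := exists_continuous_fourierIntegral α hf
  obtain rfl : F = G := ContinuousMap.ext fun γ => by rw [hF, hG]
  have h := (hs.mapL (ContinuousMap.toLp 2 ν ℂ)).mapL (innerSL ℂ (ContinuousMap.toLp 2 ν ℂ (evalInv x)))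
  have h2 := hasSum_single x (f := fun y => (innerSL ℂ (ContinuousMap.toLp 2 ν ℂ (evalInv x)))
    (ContinuousMap.toLp 2 ν ℂ (((α.real {1} : ℂ) * f y) • evalInv y))) (by
      intro y hy
      simp [inner_evalInv, hy.symm])
  have h3 := h.unique h2
  rw [innerSL_apply_apply] at h3
  rw [h3, innerSL_apply_apply, map_smul, inner_smul_right, inner_evalInv, if_pos rfl]
  have : (α.real {1} : ℂ) * (ν.real Set.univ : ℂ) = 1 := by exact_mod_cast hν
  linear_combination f x * this

theorem norm_sq_fourier (ν : Measure (PontryaginDual X)) [IsFiniteMeasure ν] [ν.IsMulLeftInvariant]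
    (hν : α.real {1} * ν.real Set.univ = 1)
    {f : Lp ℂ 2 α} (hf : Integrable f α) {F : C(PontryaginDual X, ℂ)}
    (hF : ∀ γ, F γ = fourierIntegral α f γ) :
    ‖ContinuousMap.toLp 2 ν ℂ F‖ = ‖f‖ := by
  obtain ⟨G, hG, hs⟩ := exists_continuous_fourierIntegral α hf
  obtain rfl : F = G := ContinuousMap.ext fun γ => by rw [hF, hG]
  have h := (hs.mapL (ContinuousMap.toLp 2 ν ℂ)).mapL (innerSL ℂ (ContinuousMap.toLp 2 ν ℂ F))
  have h1 : inner ℂ (ContinuousMap.toLp 2 ν ℂ F) (ContinuousMap.toLp 2 ν ℂ F) =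
      inner ℂ f f := by
    have hi : Integrable (fun x => inner ℂ (f x) (f x)) α := L2.integrable_inner f f
    rw [L2.inner_def f f, (integral_eq_tsum α hi).2, ← innerSL_apply_apply ℂ, ← h.tsum_eq]
    refine tsum_congr fun x => ?_
    rw [map_smul, innerSL_apply_apply, inner_smul_right, ← inner_conj_symm,
      inner_fourier α ν hν hf hF]
    simp [mul_assoc, Complex.mul_conj']
  rw [inner_self_eq_norm_sq_to_K, inner_self_eq_norm_sq_to_K] at h1
  have h2 : ‖ContinuousMap.toLp 2 ν ℂ F‖ ^ 2 = ‖f‖ ^ 2 := by exact_mod_cast h1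
  exact (pow_left_inj₀ (norm_nonneg _) (norm_nonneg _) two_ne_zero).1 h2

theorem ae_eq_discrete {f g : X → ℂ} (h : f =ᵐ[α] g) : f = g := by
  funext x
  by_contra hx
  have h0 : α {x} = 0 := measure_mono_null (by
    rintro y rfl; exact hx) (ae_iff.1 h)
  exact ((isOpen_discrete ({x} : Set X)).measure_pos α ⟨x, rfl⟩).ne' h0

theorem integrable_single :
    Integrable (open Classical in Pi.single (1 : X) (1 : ℂ) : X → ℂ) α := by
  classical
  rw [discreteHaar_eq_smul_count α]
  refine Integrable.smul_measure ?_ (isCompact_singleton.measure_lt_top).ne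
  rw [integrable_count_iff]
  refine summable_of_ne_finset_zero (s := {1}) fun x hx => ?_
  have : x ≠ 1 := by simpa using hx
  simp [this]

theorem isDualHaar_iff (ν : Measure (PontryaginDual X)) :
    IsDualHaar α ν ↔ ν.IsHaarMeasure ∧ ν.Regular ∧ α.real {1} * ν.real Set.univ = 1 := by
  classical
  constructor
  · rintro ⟨h1, h2, h3⟩
    refine ⟨h1, h2, ?_⟩
    have h := (h3 _ isPosDefFun_single (integrable_single α)).2 1
    have hF : ∀ γ, fourierIntegral α (open Classical in Pi.single (1 : X) (1 : ℂ)) γ =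
        α.real {1} := by
      intro γ
      have : (fun x => (open Classical in Pi.single (1 : X) (1 : ℂ) : X → ℂ) x * (γ x⁻¹ : ℂ)) =
          Set.indicator {1} (fun _ => 1) := by
        funext x
        by_cases hx : x = 1
        · subst hx; simp
        · simp [hx]
      rw [fourierIntegral, this, integral_indicator_const _ (measurableSet_singleton 1)]
      simp
    simp_rw [hF] at h
    simp only [map_one, Circle.coe_one, mul_one, integral_const, Pi.single_eq_same] at h
    rw [mul_comm]
    have h' : (1 : ℂ) = ((ν.real Set.univ * α.real {1} : ℝ) : ℂ) := by
      rw [h]; simp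
    exact_mod_cast h'.symm
  · rintro ⟨h1, h2, hν⟩
    refine ⟨h1, h2, fun f _ hf => ?_⟩
    obtain ⟨F, hF, -⟩ := exists_continuous_fourierIntegral α hf
    have hF' : fourierIntegral α f = F := funext fun γ => (hF γ).symm
    rw [hF']
    refine ⟨F.continuous.integrable_of_hasCompactSupport (HasCompactSupport.of_compactSpace F),
      fun x => ?_⟩
    rw [← inner_fourier α ν hν hf hF x, ContinuousMap.inner_toLp]
    refine integral_congr_ae (Filter.Eventually.of_forall fun γ => ?_)
    change F γ * conj (γ x⁻¹ : ℂ) = F γ * (γ x : ℂ)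
    rw [← Circle.coe_inv_eq_conj, ← map_inv, inv_inv]

/-- On the dual of a discrete abelian group there is exactly one measure with the dual
normalization. -/
theorem existsUnique_isDualHaar : ∃! ν : Measure (PontryaginDual X), IsDualHaar α ν := by
  have hpos : α {1} ≠ 0 := ((isOpen_discrete ({1} : Set X)).measure_pos α ⟨1, rfl⟩).ne'
  have hfin : α {1} ≠ ∞ := (isCompact_singleton.measure_lt_top).ne
  let μ : Measure (PontryaginDual X) := Measure.haarMeasure ⊤
  have hμ : μ Set.univ = 1 := by
    have := Measure.haarMeasure_self (K₀ := (⊤ : TopologicalSpace.PositiveCompacts (PontryaginDual X)))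
    simpa using this
  refine ⟨(α {1})⁻¹ • μ, ?_, ?_⟩
  · refine (isDualHaar_iff α _).2 ⟨?_, ?_, ?_⟩
    · exact Measure.IsHaarMeasure.smul μ (by simpa using hfin) (by simpa using hpos)
    · exact Measure.Regular.smul (by simpa using hpos)
    · simp only [Measure.real, Measure.smul_apply, hμ, smul_eq_mul, mul_one]
      rw [← ENNReal.toReal_mul, ENNReal.mul_inv_cancel hpos hfin, ENNReal.toReal_one]
  · intro ν hν
    obtain ⟨h1, h2, h3⟩ := (isDualHaar_iff α ν).1 hν
    have h4 := Measure.isMulLeftInvariant_eq_smul_of_regular ν μ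
    have h5 : ν Set.univ = (α {1})⁻¹ := by
      have hν0 : ν Set.univ ≠ ∞ := measure_ne_top _ _
      refine ENNReal.eq_inv_of_mul_eq_one_left ?_
      rw [← ENNReal.toReal_eq_one_iff, ENNReal.toReal_mul, mul_comm]
      exact h3
    have h6 : ν Set.univ = ν.haarScalarFactor μ := by
      conv_lhs => rw [h4]
      simp [hμ]
    rw [h6] at h5
    rw [h4, ← h5]
    rfl

/-- The Fourier transform on `L¹ ∩ L²` has exactly one extension to a linear isometry on `L²`. -/
theorem existsUnique_plancherel {ν : Measure (PontryaginDual X)} (hν : IsDualHaar α ν) :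
    ∃! T : Lp ℂ 2 α →ₗᵢ[ℂ] Lp ℂ 2 ν, ∀ f : Lp ℂ 2 α, Integrable f α →
      T f =ᵐ[ν] fourierIntegral α f := by
  obtain ⟨h1, h2, h3⟩ := (isDualHaar_iff α ν).1 hν
  let S : Submodule ℂ (Lp ℂ 2 α) :=
    { carrier := {f | Integrable f α}
      add_mem' := fun {f g} hf hg => (hf.add hg).congr (Lp.coeFn_add f g).symm
      zero_mem' := (integrable_zero _ _ _).congr (Lp.coeFn_zero ℂ 2 α).symm
      smul_mem' := fun c f hf => (Integrable.smul c hf).congr (Lp.coeFn_smul c f).symm }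
  have hS : DenseRange S.subtype := by
    refine (Lp.simpleFunc.denseRange (E := ℂ) (μ := α) (p := 2) (by simp)).mono ?_
    rintro _ ⟨g, rfl⟩
    refine ⟨⟨g, ?_⟩, rfl⟩
    have hg := Lp.simpleFunc.memLp g
    rw [SimpleFunc.memLp_iff_integrable (by simp) (by simp)] at hg
    exact hg.congr (Lp.simpleFunc.toSimpleFunc_eq_toFun g)
  choose F hF hsum using fun f : S => exists_continuous_fourierIntegral α f.2
  let A : S →ₗ[ℂ] Lp ℂ 2 ν :=
    { toFun := fun f => ContinuousMap.toLp 2 ν ℂ (F f)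
      map_add' := fun f g => by
        rw [← map_add]
        congr 1
        refine (hsum (f + g)).unique ?_
        convert (hsum f).add (hsum g) using 1
        funext x
        have := congrFun (ae_eq_discrete α (Lp.coeFn_add (f : Lp ℂ 2 α) g)) x
        simp only [Submodule.coe_add, this, Pi.add_apply]
        rw [← add_smul, mul_add]
      map_smul' := fun c f => by
        rw [RingHom.id_apply, ← map_smul]
        congr 1
        refine (hsum (c • f)).unique ?_
        convert (hsum f).const_smul c using 1
        funext x
        have := congrFun (ae_eq_discrete α (Lp.coeFn_smul c (f : Lp ℂ 2 α))) x
        simp only [Submodule.coe_smul, this, Pi.smul_apply]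
        rw [smul_smul, smul_eq_mul]
        congr 1
        ring }
  have hA : ∀ f : S, ‖A f‖ = ‖(f : Lp ℂ 2 α)‖ := fun f => norm_sq_fourier α ν h3 f.2 (hF f)
  let B : Lp ℂ 2 α →L[ℂ] Lp ℂ 2 ν := A.extendOfNorm S.subtype
  have hB : ∀ f : S, B f = A f :=
    fun f => LinearMap.extendOfNorm_eq hS ⟨1, fun f => by rw [one_mul, hA]; rfl⟩ f
  have hBn : ∀ f, ‖B f‖ = ‖f‖ := by
    intro f
    refine hS.induction_on (p := fun f => ‖B f‖ = ‖f‖) f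
      (isClosed_eq (B.continuous.norm) continuous_norm) fun g => ?_
    change ‖B (g : Lp ℂ 2 α)‖ = ‖(g : Lp ℂ 2 α)‖
    rw [hB, hA]
  refine ⟨⟨B.toLinearMap, hBn⟩, fun f hf => ?_, fun T hT => ?_⟩
  · change B f =ᵐ[ν] _
    have := hB ⟨f, hf⟩
    change B f = ContinuousMap.toLp 2 ν ℂ (F ⟨f, hf⟩) at this
    rw [this]
    refine (ContinuousMap.coeFn_toLp ν _).trans (Filter.Eventually.of_forall fun γ => hF _ γ)
  · have : (T : Lp ℂ 2 α → Lp ℂ 2 ν) = B := by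
      refine hS.equalizer T.continuous B.continuous ?_
      funext f
      change T (f : Lp ℂ 2 α) = B (f : Lp ℂ 2 α)
      rw [hB]
      refine Lp.ext ((hT f f.2).trans ?_)
      exact ((ContinuousMap.coeFn_toLp ν _).trans
        (Filter.Eventually.of_forall fun γ => hF _ γ)).symm
    ext1 f
    exact congrFun this f

/-- The dual Haar measure `α̂` on `X̂`. -/
noncomputable def dualHaar : Measure (PontryaginDual X) :=
  (existsUnique_isDualHaar α).exists.choose

theorem isDualHaar_dualHaar : IsDualHaar α (dualHaar α) :=
  (existsUnique_isDualHaar α).exists.choose_spec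

/-- The Fourier transform on `L²(X)`: the unique linear isometry `L²(X, α) → L²(X̂, α̂)` that
agrees with the Fourier integral on integrable functions. -/
noncomputable def fourierL2 : Lp ℂ 2 α →ₗᵢ[ℂ] Lp ℂ 2 (dualHaar α) :=
  (existsUnique_plancherel α (isDualHaar_dualHaar α)).exists.choose

theorem fourierL2_ae_eq (f : Lp ℂ 2 α) (hf : Integrable f α) :
    fourierL2 α f =ᵐ[dualHaar α] fourierIntegral α f :=
  (existsUnique_plancherel α (isDualHaar_dualHaar α)).exists.choose_spec f hf

/-- `C_{p,q}`: the supremum of `‖f̂‖_q` over all `f ∈ L²(X) ∩ L^p(X)` with `‖f‖_p = 1`, as an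
extended nonnegative real. For `0 < p < ∞`, `eLpNorm f p α = (∫ |f|^p dα)^{1/p}` also when `p < 1`. -/
noncomputable def fourierNorm (p q : ℝ≥0∞) : ℝ≥0∞ :=
  ⨆ (f : Lp ℂ 2 α) (_ : MemLp f p α) (_ : eLpNorm f p α = 1),
    eLpNorm (fourierL2 α f) q (dualHaar α)
end

end LCAFourier

/-! Write `a` for the mass of a point of `X` and `M` for the total mass of the dual; the
normalization of the dual measure amounts to `a * M = 1`.

Finite case. For `1 < p ≤ 2` the Hausdorff–Young inequality holds with constant 1 from `L^p` to the
conjugate space `L^r`; for `p ≤ 1` the sup of the transform is at most the `L¹` norm, which the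
`L^p` norm controls because atoms have equal mass. Hölder on the dual, of finite mass `M`, lowers
the target exponent to `q` and produces the stated power of `M` (`eLpNorm_finset_le`). This is done
for finitely supported functions and passed to all of `L²` by Fatou (`eLpNorm_fourierL2_le`). A
point mass, whose transform is constant, attains the bound (`fourierNorm_eq`). Hausdorff–Young
itself comes from Hadamard's three lines theorem (`norm_integral_le_of_threeLines`).

Infinite case, `q > 2`. Take a finite `A` of size `N` whose quotient set has at most `2N` elements,
and let `f` count representations as quotients from `A`. Then `f ≤ N` on a set of size at most `2N`,
so its `L^p` norm is `O(N^(1 + 1/p))`. Its transform is `a|P|²` with `P` the character sum over `A`;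
the second and fourth moments of `P` force the `L^q` norm to be at least a constant times `N^(2 -
1/q)`, which wins when `1/p + 1/q < 1` (`fourierNorm_eq_top_of_two_lt`).

Infinite case, `q ≤ 2 < p`. Take the indicator of a Sidon-like `A`, for which the fourth moment of
`P` is `O(N²)`. Then `|P|` is of order `√N` on a substantial set, so the `L^q` norm is at least of
order `N^(1/2)`, against `N^(1/p)` for the function (`fourierNorm_eq_top_of_le_two`). -/

namespace LCAFourier

/-! ### Hausdorff–Young by complex interpolation on a compact space. -/

section ThreeLines

variable {Ω : Type*} [TopologicalSpace Ω] [CompactSpace Ω] [MeasurableSpace Ω] [BorelSpace Ω]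
  {ν : Measure Ω} [IsFiniteMeasure ν]

theorem integrable_of_continuous {E : Type*} [NormedAddCommGroup E] {f : Ω → E}
    (hf : Continuous f) : Integrable f ν :=
  hf.integrable_of_hasCompactSupport (HasCompactSupport.of_compactSpace f)

/-- Supplies the holomorphy required by the three lines theorem. Differentiation under the integral
is justified by a constant bound on the unit ball around `z₀`, available since `k` and `L` are
bounded and the measure is finite. -/
theorem differentiable_integral_mul_exp (k L : C(Ω, ℂ)) :
    Differentiable ℂ fun z : ℂ => ∫ ω, k ω * Complex.exp (z * L ω) ∂ν := by
  intro z₀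
  refine (hasDerivAt_integral_of_dominated_loc_of_deriv_le (μ := ν)
    (F := fun z ω => k ω * Complex.exp (z * L ω))
    (F' := fun z ω => k ω * (Complex.exp (z * L ω) * (1 * L ω)))
    (bound := fun _ => ‖k‖ * (Real.exp ((‖z₀‖ + 1) * ‖L‖) * ‖L‖))
    (Metric.ball_mem_nhds z₀ one_pos) ?_ ?_ ?_ ?_ ?_ ?_).2.differentiableAt
  · exact Filter.Eventually.of_forall fun z =>
      (Continuous.aestronglyMeasurable (by fun_prop))
  · exact integrable_of_continuous (by fun_prop)
  · exact Continuous.aestronglyMeasurable (by fun_prop)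
  · refine Filter.Eventually.of_forall fun ω z hz => ?_
    have hz' : ‖z‖ ≤ ‖z₀‖ + 1 := by
      have := norm_le_norm_add_norm_sub z₀ z
      rw [Metric.mem_ball, dist_eq_norm, norm_sub_rev] at hz
      linarith
    rw [norm_mul, norm_mul, one_mul]
    gcongr
    · exact k.norm_coe_le_norm ω
    · rw [Complex.norm_exp]
      refine Real.exp_le_exp.2 ((Complex.re_le_norm _).trans ?_)
      rw [norm_mul]
      gcongr
      exact L.norm_coe_le_norm ω
    · exact L.norm_coe_le_norm ω
  · exact integrable_const _
  · refine Filter.Eventually.of_forall fun ω z _ => ?_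
    exact (((hasDerivAt_id z).mul_const (L ω)).cexp).const_mul (k ω)

/-- Cauchy–Schwarz for continuous functions on a compact space. -/
theorem norm_integral_mul_le_sqrt {f g : Ω → ℂ} (hf : Continuous f) (hg : Continuous g) :
    ‖∫ ω, f ω * g ω ∂ν‖ ≤
      (∫ ω, ‖f ω‖ ^ 2 ∂ν) ^ (1 / 2 : ℝ) * (∫ ω, ‖g ω‖ ^ 2 ∂ν) ^ (1 / 2 : ℝ) := by
  have h := integral_mul_norm_le_Lp_mul_Lq (μ := ν) (f := f) (g := g) (p := 2) (q := 2)
    Real.HolderConjugate.two_two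
    (MemLp.mono_exponent (q := ∞) (memLp_top_of_bound hf.aestronglyMeasurable
      ‖(⟨f, hf⟩ : C(Ω, ℂ))‖ (Filter.Eventually.of_forall fun ω =>
        (⟨f, hf⟩ : C(Ω, ℂ)).norm_coe_le_norm ω)) le_top)
    (MemLp.mono_exponent (q := ∞) (memLp_top_of_bound hg.aestronglyMeasurable
      ‖(⟨g, hg⟩ : C(Ω, ℂ))‖ (Filter.Eventually.of_forall fun ω =>
        (⟨g, hg⟩ : C(Ω, ℂ)).norm_coe_le_norm ω)) le_top)
  simp only [Real.rpow_two] at h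
  refine (norm_integral_le_integral_norm _).trans ?_
  simpa only [norm_mul] using h

variable {ι : Type*} [Fintype ι]

/-- The duality form of Hausdorff–Young. The coefficients are deformed to modulus `|c|^(p(1 - z/2))`
and the test function to `v w^(r(1 - z/2))`. On `Re z = 0` the trivial sup bound against the `L¹`
norm applies; on `Re z = 1`, Cauchy–Schwarz and the `L²` hypothesis. Strict positivity of `w` makes
its complex powers continuous. -/
theorem norm_integral_le_of_threeLines (e : ι → C(Ω, ℂ)) (he : ∀ i ω, ‖e i ω‖ ≤ 1)
    {a : ℝ} (ha : 0 ≤ a)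
    (h2 : ∀ c : ι → ℂ, ∫ ω, ‖∑ i, a * c i * e i ω‖ ^ 2 ∂ν ≤ a * ∑ i, ‖c i‖ ^ 2)
    {p r : ℝ} (hpr : p.HolderConjugate r) (hp2 : p ≤ 2) (c : ι → ℂ)
    (v : C(Ω, ℂ)) (hv : ∀ ω, ‖v ω‖ ≤ 1) (w : C(Ω, ℝ)) (hw : ∀ ω, 0 < w ω) :
    ‖∫ ω, (∑ i, a * c i * e i ω) * (v ω * (w ω ^ (r - 1) : ℝ)) ∂ν‖ ≤
      (a * ∑ i, ‖c i‖ ^ p) ^ (1 / p) * (∫ ω, w ω ^ r ∂ν) ^ (1 / p) := by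
  have hp0 : 0 < p := hpr.pos
  have hr0 : 0 < r := hpr.symm.pos
  -- Polar decomposition. Where `c i = 0`, division by zero gives `u i = 0`, so the junk value of
  -- `log 0` below is harmless.
  set u : ι → ℂ := fun i => c i / ‖c i‖ with hu
  have hu1 : ∀ i, ‖u i‖ ≤ 1 := fun i => by
    simp only [hu, norm_div, Complex.norm_real, norm_norm]
    exact div_self_le_one _
  set ℓ : ι → ℝ := fun i => p * Real.log ‖c i‖ with hℓ
  set L : C(Ω, ℝ) := ⟨fun ω => r * Real.log (w ω),
    continuous_const.mul (w.continuous.log fun ω => (hw ω).ne')⟩ with hL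
  have hwe : ∀ ω (s : ℝ), Real.exp (s * L ω) = w ω ^ (r * s) := fun ω s => by
    rw [Real.rpow_def_of_pos (hw ω)]
    congr 1
    simp only [hL, ContinuousMap.coe_mk]
    ring
  have hce : ∀ i (s : ℝ), 0 < s → ‖u i‖ * Real.exp (s * ℓ i) = ‖c i‖ ^ (p * s) := fun i s hs => by
    rcases eq_or_ne (c i) 0 with h | h
    · simp [hu, h, Real.zero_rpow (mul_pos hp0 hs).ne']
    · have h' : 0 < ‖c i‖ := norm_pos_iff.2 h
      simp only [hu, hℓ, norm_div, Complex.norm_real, norm_norm, div_self h'.ne', one_mul]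
      rw [Real.rpow_def_of_pos h']
      congr 1
      ring
  let C : ℂ → ι → ℂ := fun z i => u i * Complex.exp ((1 - z / 2) * ℓ i)
  let G : ℂ → Ω → ℂ := fun z ω => v ω * Complex.exp ((1 - z / 2) * L ω)
  let Φ : ℂ → ℂ := fun z => ∫ ω, (∑ i, a * C z i * e i ω) * G z ω ∂ν
  have hre : ∀ (z : ℂ) (x : ℝ), ((1 - z / 2) * (x : ℂ)).re = (1 - z.re / 2) * x := fun z x => by
    have h2 : (z / 2).re = z.re / 2 := by
      rw [show (2 : ℂ) = ((2 : ℝ) : ℂ) by norm_num, Complex.div_ofReal_re]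
    rw [Complex.re_mul_ofReal, Complex.sub_re, Complex.one_re, h2]
  have hC : ∀ z i, ‖C z i‖ = ‖u i‖ * Real.exp ((1 - z.re / 2) * ℓ i) := fun z i => by
    rw [norm_mul, Complex.norm_exp, hre]
  have hG : ∀ z ω, ‖G z ω‖ ≤ Real.exp ((1 - z.re / 2) * L ω) := fun z ω => by
    rw [norm_mul, Complex.norm_exp, hre]
    exact mul_le_of_le_one_left (Real.exp_pos _).le (hv ω)
  have hGc : ∀ z, Continuous (G z) := fun z => by fun_prop
  have hTc : ∀ z, Continuous fun ω => ∑ i, a * C z i * e i ω := fun z => by fun_prop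
  have hT1 : ∀ z ω, ‖∑ i, a * C z i * e i ω‖ ≤ a * ∑ i, ‖C z i‖ := fun z ω => by
    refine (norm_sum_le _ _).trans ?_
    rw [Finset.mul_sum]
    refine Finset.sum_le_sum fun i _ => ?_
    rw [norm_mul, norm_mul, Complex.norm_real, Real.norm_of_nonneg ha]
    exact mul_le_of_le_one_right (by positivity) (he i ω)
  have hΦ1 : ∀ z, ‖Φ z‖ ≤ (a * ∑ i, ‖C z i‖) * ∫ ω, Real.exp ((1 - z.re / 2) * L ω) ∂ν := by
    intro z
    refine (norm_integral_le_integral_norm _).trans ?_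
    rw [← integral_const_mul]
    refine integral_mono (integrable_of_continuous (by fun_prop))
      (integrable_of_continuous (by fun_prop)) fun ω => ?_
    rw [norm_mul]
    exact mul_le_mul (hT1 z ω) (hG z ω) (norm_nonneg _) (by positivity)
  set A : ℝ := a * ∑ i, ‖c i‖ ^ p with hA
  set B : ℝ := ∫ ω, w ω ^ r ∂ν with hB
  have hA0 : 0 ≤ A := by positivity
  have hB0 : 0 ≤ B := integral_nonneg fun ω => Real.rpow_nonneg (hw ω).le _
  have hwc : ∀ s : ℝ, Continuous fun ω => w ω ^ s := fun s =>
    w.continuous.rpow_const fun ω => Or.inl (hw ω).ne'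
  have hd : Differentiable ℂ Φ := by
    have h : Φ = fun z => ∑ i, a * C z i *
        ∫ ω, (e i * v) ω * Complex.exp ((1 - z / 2) *
          (⟨fun ω => (L ω : ℂ), by fun_prop⟩ : C(Ω, ℂ)) ω) ∂ν := by
      funext z
      simp only [Φ, Finset.sum_mul]
      rw [integral_finsetSum _ fun i _ => integrable_of_continuous (by fun_prop)]
      refine Finset.sum_congr rfl fun i _ => ?_
      rw [← integral_const_mul]
      refine integral_congr_ae (Filter.Eventually.of_forall fun ω => ?_)
      simp only [G, ContinuousMap.mul_apply, ContinuousMap.coe_mk]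
      ring
    rw [h]
    refine Differentiable.fun_sum fun i _ => ?_
    refine Differentiable.mul (by simp only [C]; fun_prop) ?_
    exact (differentiable_integral_mul_exp (ν := ν) (e i * v) _).comp
      (g := fun z => ∫ ω, (e i * v) ω * Complex.exp (z *
          (⟨fun ω => (L ω : ℂ), by fun_prop⟩ : C(Ω, ℂ)) ω) ∂ν)
      (f := fun z : ℂ => 1 - z / 2) (by fun_prop)
  -- The point of the strip at which `1 - t/2 = 1/p`: there the deformed coefficients are `c` and
  -- the deformed test function is `v w^(r/p) = v w^(r - 1)`.
  set t : ℝ := 2 / r with ht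
  have hr2 : 2 ≤ r := by
    have := hpr.symm.one_sub_inv
    have h3 : (2:ℝ)⁻¹ ≤ p⁻¹ := inv_anti₀ hp0 hp2
    have h4 : r⁻¹ ≤ 2⁻¹ := by linarith
    exact (inv_le_inv₀ hr0 two_pos).1 h4
  have ht1 : t ≤ 1 := (div_le_one hr0).2 hr2
  have ht0 : 0 ≤ t := by positivity
  have htp : 1 - t / 2 = 1 / p := by
    have := hpr.symm.one_sub_inv
    rw [ht, one_div, ← this]; ring
  have key := Complex.HadamardThreeLines.norm_le_interp_of_mem_verticalClosedStrip₀₁' Φ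
    (z := (t : ℂ)) (a := A * B) (b := A ^ (1 / 2 : ℝ) * B ^ (1 / 2 : ℝ))
    (by simp [Complex.HadamardThreeLines.verticalClosedStrip, ht0, ht1])
    hd.diffContOnCl ?_ ?_ ?_
  · rw [Complex.ofReal_re] at key
    have hl : Φ t = ∫ ω, (∑ i, a * c i * e i ω) * (v ω * (w ω ^ (r - 1) : ℝ)) ∂ν := by
      refine integral_congr_ae (Filter.Eventually.of_forall fun ω => ?_)
      have h3 : (1 - (t : ℂ) / 2) = ((1 / p : ℝ) : ℂ) := by
        rw [← htp]; push_cast; ring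
      have h4 : ∀ i, C t i = c i := fun i => by
        simp only [C, h3]
        rcases eq_or_ne (c i) 0 with h | h
        · simp [hu, h]
        · have h' : 0 < ‖c i‖ := norm_pos_iff.2 h
          have h5 : 1 / p * ℓ i = Real.log ‖c i‖ := by
            simp only [hℓ]; field_simp
          rw [← Complex.ofReal_mul, h5, ← Complex.ofReal_exp, Real.exp_log h']
          simp only [hu]
          exact div_mul_cancel₀ _ (by exact_mod_cast h'.ne')
      have h6 : r - 1 = r * (1 / p) := by
        have := hpr.symm.one_sub_inv
        rw [one_div, ← this, mul_sub, mul_inv_cancel₀ hr0.ne', mul_one]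
      simp only [h4, G, h3]
      rw [← Complex.ofReal_mul, ← Complex.ofReal_exp, hwe, h6]
    rw [hl] at key
    refine key.trans_eq ?_
    -- The exponents interpolate to `(1 - t) + t/2 = 1/p`, so no normalization of `c` or `w` is
    -- needed.
    have h7 : ∀ D : ℝ, 0 ≤ D → D ^ (1 - t) * (D ^ (1 / 2 : ℝ)) ^ t = D ^ (1 / p) := by
      intro D hD
      rw [← Real.rpow_mul hD, ← Real.rpow_add_of_nonneg hD (by linarith) (by positivity), ← htp]
      congr 1
      ring
    clear_value A B
    rw [Real.mul_rpow hA0 hB0, Real.mul_rpow (by positivity) (by positivity), ← h7 A hA0,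
      ← h7 B hB0]
    ring
  · refine ⟨(a * ∑ i, Real.exp |ℓ i|) * ∫ ω, Real.exp |L ω| ∂ν, ?_⟩
    rintro _ ⟨z, hz, rfl⟩
    have hz : 0 ≤ z.re ∧ z.re ≤ 1 := hz
    -- In the strip the factor `1 - Re z / 2` lies in `[1/2, 1]`, whence a bound uniform in `z`.
    have hb : ∀ x : ℝ, (1 - z.re / 2) * x ≤ |x| := fun x => by
      refine (le_abs_self _).trans ?_
      rw [abs_mul]
      refine mul_le_of_le_one_left (abs_nonneg _) ?_
      rw [abs_le]
      constructor <;> linarith [hz.1, hz.2]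
    refine (hΦ1 z).trans ?_
    gcongr with i _
    · rw [hC]
      refine (mul_le_of_le_one_left (Real.exp_pos _).le (hu1 i)).trans ?_
      exact Real.exp_le_exp.2 (hb _)
    · exact integrable_of_continuous (by fun_prop)
    · exact integrable_of_continuous (by fun_prop)
    · exact fun ω => Real.exp_le_exp.2 (hb _)
  · intro z hz
    have hz : z.re = 0 := hz
    refine (hΦ1 z).trans_eq ?_
    simp only [hC, hce _ (1 - z.re / 2) (by rw [hz]; norm_num), hwe]
    simp [hz, hA, hB]
  · intro z hz
    have hz : z.re = 1 := hz
    refine (norm_integral_mul_le_sqrt (hTc z) (hGc z)).trans ?_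
    have h3 : ∀ x : ℝ, 0 ≤ x → ∀ s : ℝ, (x ^ (s * (1 - z.re / 2))) ^ 2 = x ^ s := fun x hx s => by
      rw [hz, ← Real.rpow_natCast, ← Real.rpow_mul hx]
      congr 1
      push_cast
      ring
    gcongr
    · refine (h2 (C z)).trans_eq ?_
      simp only [hC, hce _ (1 - z.re / 2) (by rw [hz]; norm_num), hA]
      congr 1
      exact Finset.sum_congr rfl fun i _ => h3 _ (norm_nonneg _) _
    · refine integral_mono (integrable_of_continuous (by fun_prop))
        (integrable_of_continuous (hwc r)) fun ω => ?_
      refine (pow_le_pow_left₀ (norm_nonneg _) (hG z ω) 2).trans_eq ?_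
      rw [hwe, h3 _ (hw ω).le]

/-- Finite Hausdorff–Young inequality from an `L²` bound and a uniform bound. -/
theorem integral_norm_rpow_le_of_l2 (e : ι → C(Ω, ℂ)) (he : ∀ i ω, ‖e i ω‖ ≤ 1)
    {a : ℝ} (ha : 0 ≤ a)
    (h2 : ∀ c : ι → ℂ, ∫ ω, ‖∑ i, a * c i * e i ω‖ ^ 2 ∂ν ≤ a * ∑ i, ‖c i‖ ^ 2)
    {p r : ℝ} (hpr : p.HolderConjugate r) (hp2 : p ≤ 2) (c : ι → ℂ) :
    (∫ ω, ‖∑ i, a * c i * e i ω‖ ^ r ∂ν) ^ (1 / r) ≤ (a * ∑ i, ‖c i‖ ^ p) ^ (1 / p) := by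
  have hp0 : 0 < p := hpr.pos
  have hr0 : 0 < r := hpr.symm.pos
  have hr2 : 2 ≤ r := by
    have := hpr.symm.one_sub_inv
    have h3 : (2:ℝ)⁻¹ ≤ p⁻¹ := inv_anti₀ hp0 hp2
    have h4 : r⁻¹ ≤ 2⁻¹ := by linarith
    exact (inv_le_inv₀ hr0 two_pos).1 h4
  let h : C(Ω, ℂ) := ⟨fun ω => ∑ i, a * c i * e i ω, by fun_prop⟩
  set H : ℝ := ∫ ω, ‖h ω‖ ^ r ∂ν with hH
  set A : ℝ := a * ∑ i, ‖c i‖ ^ p with hA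
  have hA0 : 0 ≤ A := by positivity
  have hH0 : 0 ≤ H := integral_nonneg fun ω => by positivity
  -- The extremal test function `conj h · |h|^(r - 2)` may vanish, so `|h|` is replaced by `|h| + ε`
  -- in the denominator and in the weight. Writing `|ε|` keeps the integrands continuous for every
  -- real `ε`, which gives the limit at 0.
  have hreg : ∀ ε : ℝ, 0 < ε → ∫ ω, ‖h ω‖ ^ 2 * (‖h ω‖ + |ε|) ^ (r - 2) ∂ν ≤
      A ^ (1 / p) * (∫ ω, (‖h ω‖ + |ε|) ^ r ∂ν) ^ (1 / p) := by
    intro ε hε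
    rw [abs_of_pos hε]
    have hpos : ∀ ω, 0 < ‖h ω‖ + ε := fun ω => by positivity
    let w : C(Ω, ℝ) := ⟨fun ω => ‖h ω‖ + ε, by fun_prop⟩
    let v : C(Ω, ℂ) := ⟨fun ω => conj (h ω) / ((‖h ω‖ + ε : ℝ) : ℂ), by
      refine Continuous.div₀ (by fun_prop) (by fun_prop) fun ω => ?_
      exact_mod_cast (hpos ω).ne'⟩
    have key := norm_integral_le_of_threeLines (ν := ν) e he ha h2 hpr hp2 c v (fun ω => by
      simp only [v, ContinuousMap.coe_mk, norm_div, RCLike.norm_conj, Complex.norm_real,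
        Real.norm_of_nonneg (hpos ω).le]
      exact (div_le_one (hpos ω)).2 (by linarith)) w hpos
    refine le_trans (le_trans (le_of_eq ?_) (Complex.re_le_norm _)) key
    have : ∀ ω, (∑ i, a * c i * e i ω) * (v ω * ((w ω ^ (r - 1) : ℝ) : ℂ)) =
        ((‖h ω‖ ^ 2 * (‖h ω‖ + ε) ^ (r - 2) : ℝ) : ℂ) := by
      intro ω
      change h ω * (conj (h ω) / ((‖h ω‖ + ε : ℝ) : ℂ) * (((‖h ω‖ + ε) ^ (r - 1) : ℝ) : ℂ)) = _
      rw [show r - 1 = (r - 2) + 1 by ring, Real.rpow_add_one (hpos ω).ne']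
      have h0 : ((‖h ω‖ + ε : ℝ) : ℂ) ≠ 0 := by exact_mod_cast (hpos ω).ne'
      have h1 : h ω * conj (h ω) = ((‖h ω‖ ^ 2 : ℝ) : ℂ) := by
        rw [Complex.mul_conj']; push_cast; rfl
      rw [Complex.ofReal_mul, Complex.ofReal_mul, ← h1]
      field_simp
    simp_rw [this]
    rw [integral_complex_ofReal, Complex.ofReal_re]
  have hcont : ∀ g : ℝ → Ω → ℝ, Continuous (Function.uncurry g) →
      Filter.Tendsto (fun ε => ∫ ω, g ε ω ∂ν) (nhdsWithin 0 (Set.Ioi 0)) (nhds (∫ ω, g 0 ω ∂ν)) := by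
    intro g hg
    have := continuous_parametric_integral_of_continuous (μ := ν) hg isCompact_univ
    simp only [Measure.restrict_univ] at this
    exact this.continuousWithinAt
  have hlim := le_of_tendsto_of_tendsto
    (hcont (fun ε ω => ‖h ω‖ ^ 2 * (‖h ω‖ + |ε|) ^ (r - 2)) (by
      refine Continuous.mul (by fun_prop) ?_
      exact Continuous.rpow_const (by fun_prop) fun _ => Or.inr (by linarith)))
    (((hcont (fun ε ω => (‖h ω‖ + |ε|) ^ r) (by
      exact Continuous.rpow_const (by fun_prop) fun _ => Or.inr hr0.le)).rpow_const
        (Or.inr (by positivity : 0 ≤ 1 / p))).const_mul (A ^ (1 / p)))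
    (Filter.eventually_of_mem self_mem_nhdsWithin hreg)
  simp only [abs_zero, add_zero] at hlim
  have h5 : ∀ x : ℝ, 0 ≤ x → x ^ 2 * x ^ (r - 2) = x ^ r := fun x hx => by
    rw [← Real.rpow_natCast, ← Real.rpow_add_of_nonneg hx (by norm_num) (by linarith)]
    congr 1
    push_cast
    ring
  simp_rw [h5 _ (norm_nonneg _)] at hlim
  change H ≤ A ^ (1 / p) * H ^ (1 / p) at hlim
  change H ^ (1 / r) ≤ A ^ (1 / p)
  rcases hH0.eq_or_lt with h0 | h0
  · rw [← h0, Real.zero_rpow (by positivity)]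
    positivity
  -- The limit inequality is `H ≤ A^(1/p) H^(1/p)`; conjugacy of the exponents allows cancelling
  -- `H^(1/p)` when `H > 0`.
  · have h6 : H ^ (1 / r) * H ^ (1 / p) = H := by
      rw [← Real.rpow_add h0, one_div, one_div, add_comm, hpr.inv_add_inv_eq_one, Real.rpow_one]
    exact le_of_mul_le_mul_right (h6.trans_le hlim) (by positivity)

end ThreeLines

/-! ### Parseval for trigonometric polynomials. -/

section Characters

variable {X : Type*} [CommGroup X] [TopologicalSpace X]

theorem norm_evalInv_apply (x : X) (γ : PontryaginDual X) : ‖evalInv x γ‖ = 1 :=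
  Circle.norm_coe (γ x⁻¹)

variable [DiscreteTopology X]

theorem integral_norm_sq_sum_evalInv (ν : Measure (PontryaginDual X)) [IsFiniteMeasure ν]
    [ν.IsMulLeftInvariant] (s : Finset X) (k : X → ℂ) :
    ∫ γ, ‖∑ x ∈ s, k x * evalInv x γ‖ ^ 2 ∂ν = ν.real Set.univ * ∑ x ∈ s, ‖k x‖ ^ 2 := by
  let P : C(PontryaginDual X, ℂ) := ∑ x ∈ s, k x • evalInv x
  have hP : ∀ γ, P γ = ∑ x ∈ s, k x * evalInv x γ := fun γ => by
    simp [P]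
  have h1 := ContinuousMap.inner_toLp ν P P (𝕜 := ℂ)
  have h2 : inner ℂ (ContinuousMap.toLp 2 ν ℂ P) (ContinuousMap.toLp 2 ν ℂ P) =
      ((ν.real Set.univ * ∑ x ∈ s, ‖k x‖ ^ 2 : ℝ) : ℂ) := by
    classical
    simp only [P, map_sum, map_smul, sum_inner, inner_sum, inner_smul_left, inner_smul_right,
      inner_evalInv]
    push_cast
    rw [Finset.mul_sum]
    refine Finset.sum_congr rfl fun x hx => ?_
    rw [Finset.sum_eq_single x]
    · rw [if_pos rfl, mul_left_comm, ← mul_assoc, Complex.conj_mul', mul_comm]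
    · intro y _ hy
      simp [hy]
    · exact fun h => absurd hx h
  rw [h2] at h1
  have h3 : ∀ γ, P γ * conj (P γ) = ((‖∑ x ∈ s, k x * evalInv x γ‖ ^ 2 : ℝ) : ℂ) := fun γ => by
    rw [Complex.mul_conj', hP]
    push_cast
    rfl
  simp_rw [h3] at h1
  rw [integral_complex_ofReal] at h1
  exact_mod_cast h1.symm

end Characters

/-! ### The value of the norm in the bounded range. -/

section Finite

variable {X : Type*} [CommGroup X] [TopologicalSpace X] [DiscreteTopology X]
  [MeasurableSpace X] [BorelSpace X] (α : Measure X) [α.IsHaarMeasure]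

instance dualHaar_isHaarMeasure : (dualHaar α).IsHaarMeasure :=
  (isDualHaar_dualHaar α).isHaar

set_option linter.unusedSectionVars false in
theorem measure_one_ne_zero : α {1} ≠ 0 :=
  ((isOpen_discrete ({1} : Set X)).measure_pos α ⟨1, rfl⟩).ne'

set_option linter.unusedSectionVars false in
theorem measure_one_ne_top : α {1} ≠ ∞ :=
  (isCompact_singleton.measure_lt_top).ne

theorem real_one_mul_dualHaar_real_univ : α.real {1} * (dualHaar α).real Set.univ = 1 :=
  ((isDualHaar_iff α _).1 (isDualHaar_dualHaar α)).2.2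

theorem real_one_pos : 0 < α.real {1} :=
  ENNReal.toReal_pos (measure_one_ne_zero α) (measure_one_ne_top α)

theorem dualHaar_univ : dualHaar α Set.univ = (α {1})⁻¹ := by
  refine ENNReal.eq_inv_of_mul_eq_one_left ?_
  rw [← ENNReal.toReal_eq_one_iff, ENNReal.toReal_mul, mul_comm]
  exact real_one_mul_dualHaar_real_univ α

theorem measure_finset (s : Finset X) : α (s : Set X) = α {1} * s.card := by
  rw [← sum_measure_singleton, Finset.sum_congr rfl fun x _ => Measure.haar_singleton α x,
    Finset.sum_const, nsmul_eq_mul, mul_comm]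

theorem memLp_indicator_finset (s : Finset X) (c : X → ℂ) (p : ℝ≥0∞) :
    MemLp (Set.indicator (s : Set X) c) p α := by
  have : Fact (α (s : Set X) < ∞) := ⟨s.finite_toSet.isCompact.measure_lt_top⟩
  rw [memLp_indicator_iff_restrict s.measurableSet]
  refine MemLp.of_bound (continuous_of_discreteTopology.aestronglyMeasurable) (∑ x ∈ s, ‖c x‖) ?_
  refine (ae_restrict_iff' s.measurableSet).2 (Filter.Eventually.of_forall fun x hx => ?_)
  exact Finset.single_le_sum (f := fun x => ‖c x‖) (fun _ _ => norm_nonneg _) hx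

/-- The finitely supported function `c · 1_s` as an element of `L²`. -/
noncomputable def finsuppL2 (s : Finset X) (c : X → ℂ) : Lp ℂ 2 α :=
  (memLp_indicator_finset α s c 2).toLp _

theorem coe_finsuppL2 (s : Finset X) (c : X → ℂ) :
    (finsuppL2 α s c : X → ℂ) = Set.indicator (s : Set X) c :=
  ae_eq_discrete α (MemLp.coeFn_toLp _)

theorem fourierL2_finsuppL2 (s : Finset X) (c : X → ℂ) :
    fourierL2 α (finsuppL2 α s c) =ᵐ[dualHaar α]
      fun γ => ∑ x ∈ s, α.real {1} * c x * evalInv x γ := by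
  have hi : Integrable (finsuppL2 α s c) α := by
    rw [coe_finsuppL2]
    exact memLp_one_iff_integrable.1 (memLp_indicator_finset α s c 1)
  refine (fourierL2_ae_eq α _ hi).trans (Filter.Eventually.of_forall fun γ => ?_)
  rw [fourierIntegral, coe_finsuppL2]
  have h : (fun x => Set.indicator (s : Set X) c x * (γ x⁻¹ : ℂ)) =
      Set.indicator (s : Set X) (fun x => c x * (γ x⁻¹ : ℂ)) := by
    funext x
    by_cases hx : x ∈ (s : Set X) <;> simp [hx]
  have h1 : Integrable (Set.indicator (s : Set X) (fun x => c x * (γ x⁻¹ : ℂ))) α :=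
    memLp_one_iff_integrable.1 (memLp_indicator_finset α s _ 1)
  simp_rw [h]
  rw [(integral_eq_tsum α h1).2, tsum_eq_sum (s := s)]
  · refine Finset.sum_congr rfl fun x hx => ?_
    rw [Set.indicator_of_mem (by exact_mod_cast hx), ← mul_assoc]
    rfl
  · intro x hx
    rw [Set.indicator_of_notMem (by exact_mod_cast hx), mul_zero]

theorem eLpNorm_indicator_finset {p : ℝ≥0∞} (hp : p ≠ 0) (hp' : p ≠ ∞) (s : Finset X)
    (c : X → ℂ) :
    eLpNorm (Set.indicator (s : Set X) c) p α =
      (α {1} * ∑ x ∈ s, ‖c x‖ₑ ^ p.toReal) ^ (1 / p.toReal) := by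
  rw [eLpNorm_indicator_eq_eLpNorm_restrict s.measurableSet,
    eLpNorm_eq_lintegral_rpow_enorm_toReal hp hp', lintegral_finset, Finset.mul_sum]
  congr 1
  refine Finset.sum_congr rfl fun x _ => ?_
  rw [Measure.haar_singleton α x, mul_comm]

/-- Hausdorff–Young for finitely supported functions, `1 < p ≤ 2`. -/
theorem hausdorffYoung_finset {p r : ℝ} (hpr : p.HolderConjugate r) (hp2 : p ≤ 2)
    (s : Finset X) (c : X → ℂ) :
    eLpNorm (fun γ => ∑ x ∈ s, α.real {1} * c x * evalInv x γ) (ENNReal.ofReal r) (dualHaar α) ≤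
      eLpNorm (Set.indicator (s : Set X) c) (ENNReal.ofReal p) α := by
  have hp0 := hpr.pos
  have hr0 := hpr.symm.pos
  have ha := real_one_pos α
  have h2 : ∀ k : s → ℂ, ∫ γ, ‖∑ x : s, α.real {1} * k x * evalInv (x : X) γ‖ ^ 2 ∂(dualHaar α) ≤
      α.real {1} * ∑ x, ‖k x‖ ^ 2 := by
    classical
    intro k
    -- Extension by zero, so that Parseval over a `Finset` applies; the resulting factor `a² M`
    -- equals `a` because `a * M = 1`.
    let k' : X → ℂ := fun x => if h : x ∈ s then k ⟨x, h⟩ else 0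
    have hk : ∀ x : s, k x = k' x := fun x => by simp [k']
    simp_rw [hk]
    have h3 : ∀ γ, ∑ x : s, α.real {1} * k' x * evalInv (x : X) γ =
        ∑ x ∈ s, α.real {1} * k' x * evalInv x γ := fun γ =>
      Finset.sum_coe_sort s fun x => α.real {1} * k' x * evalInv x γ
    simp_rw [h3]
    rw [integral_norm_sq_sum_evalInv (dualHaar α) s fun x => α.real {1} * k' x,
      Finset.sum_coe_sort s fun x => ‖k' x‖ ^ 2]
    simp_rw [norm_mul, mul_pow, ← Finset.mul_sum, Complex.norm_real, Real.norm_of_nonneg ha.le]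
    refine le_of_eq ?_
    linear_combination (α.real {1} * ∑ x ∈ s, ‖k' x‖ ^ 2) * real_one_mul_dualHaar_real_univ α
  have key := integral_norm_rpow_le_of_l2 (ν := dualHaar α) (fun x : s => evalInv (x : X))
    (fun x γ => (norm_evalInv_apply _ _).le) ha.le h2 hpr hp2 (fun x => c x)
  simp_rw [fun γ => Finset.sum_coe_sort s fun x => α.real {1} * c x * evalInv x γ,
    Finset.sum_coe_sort s fun x => ‖c x‖ ^ p] at key
  have hc : Continuous fun γ => ∑ x ∈ s, α.real {1} * c x * evalInv x γ := by fun_prop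
  have hm : MemLp (fun γ => ∑ x ∈ s, α.real {1} * c x * evalInv x γ) (ENNReal.ofReal r)
      (dualHaar α) :=
    MemLp.of_bound hc.aestronglyMeasurable (∑ x ∈ s, ‖α.real {1} * c x‖)
      (Filter.Eventually.of_forall fun γ => (norm_sum_le _ _).trans
        (Finset.sum_le_sum fun x _ => by rw [norm_mul _ (evalInv x γ), norm_evalInv_apply, mul_one]))
  rw [hm.eLpNorm_eq_integral_rpow_norm (by simpa using hr0) ENNReal.ofReal_ne_top,
    eLpNorm_indicator_finset α (by simpa using hp0) ENNReal.ofReal_ne_top,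
    ENNReal.toReal_ofReal hr0.le, ENNReal.toReal_ofReal hp0.le, ← one_div]
  refine (ENNReal.ofReal_le_ofReal key).trans_eq ?_
  rw [← ENNReal.ofReal_rpow_of_nonneg (by positivity) (by positivity), ENNReal.ofReal_mul ha.le,
    ENNReal.ofReal_sum_of_nonneg fun _ _ => by positivity, Measure.real,
    ENNReal.ofReal_toReal (measure_one_ne_top α)]
  simp_rw [← ENNReal.ofReal_rpow_of_nonneg (norm_nonneg _) hp0.le, ofReal_norm]

/-- Subadditivity of `x ↦ x^p` for `p ≤ 1`. -/
theorem sum_le_rpow_sum_rpow {ι : Type*} (s : Finset ι) (f : ι → ℝ≥0∞) {p : ℝ} (hp0 : 0 < p)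
    (hp1 : p ≤ 1) : ∑ i ∈ s, f i ≤ (∑ i ∈ s, f i ^ p) ^ (1 / p) := by
  have h := Finset.le_sum_of_subadditive (fun x : ℝ≥0∞ => x ^ p) (by simp [hp0])
    (fun a b => ENNReal.rpow_add_le_add_rpow a b hp0.le hp1) s f
  calc ∑ i ∈ s, f i = ((∑ i ∈ s, f i) ^ p) ^ (1 / p) := by
        rw [← ENNReal.rpow_mul, mul_one_div_cancel hp0.ne', ENNReal.rpow_one]
    _ ≤ _ := by gcongr

/-- Characters have modulus 1, so the sup is at most the `L¹` norm; the comparison of `ℓ¹` with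
`ℓ^p` leaves the factor `a^(1 - 1/p)`, a power of the dual mass. -/
theorem eLpNorm_top_finset_le {p : ℝ≥0∞} (hp : p ≠ 0) (hp1 : p ≤ 1)
    (s : Finset X) (c : X → ℂ) :
    eLpNorm (fun γ => ∑ x ∈ s, α.real {1} * c x * evalInv x γ) ∞ (dualHaar α) ≤
      eLpNorm (Set.indicator (s : Set X) c) p α *
        dualHaar α Set.univ ^ (1 / p.toReal - 1) := by
  have hp' : p ≠ ∞ := (hp1.trans_lt ENNReal.one_lt_top).ne
  have hp0 : 0 < p.toReal := ENNReal.toReal_pos hp hp'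
  have hpr1 : p.toReal ≤ 1 := by
    simpa using ENNReal.toReal_mono ENNReal.one_ne_top hp1
  have h1 : eLpNorm (fun γ => ∑ x ∈ s, α.real {1} * c x * evalInv x γ) ∞ (dualHaar α) ≤
      α {1} * ∑ x ∈ s, ‖c x‖ₑ := by
    rw [eLpNorm_exponent_top]
    refine eLpNormEssSup_le_of_ae_enorm_bound (Filter.Eventually.of_forall fun γ => ?_)
    refine (enorm_sum_le _ _).trans_eq ?_
    rw [Finset.mul_sum]
    refine Finset.sum_congr rfl fun x _ => ?_
    have he : ‖evalInv x γ‖ₑ = 1 := by rw [← ofReal_norm, norm_evalInv_apply, ENNReal.ofReal_one]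
    have hr : ‖(α.real {1} : ℂ)‖ₑ = α {1} := by
      rw [← ofReal_norm, Complex.norm_real, Real.norm_of_nonneg (real_one_pos α).le, Measure.real,
        ENNReal.ofReal_toReal (measure_one_ne_top α)]
    rw [enorm_mul, enorm_mul, he, hr, mul_one]
  refine h1.trans ?_
  rw [eLpNorm_indicator_finset α hp hp', dualHaar_univ, ENNReal.inv_rpow, ← ENNReal.rpow_neg,
    ENNReal.mul_rpow_of_nonneg _ _ (by positivity), mul_right_comm,
    ← ENNReal.rpow_add _ _ (measure_one_ne_zero α) (measure_one_ne_top α)]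
  rw [show 1 / p.toReal + -(1 / p.toReal - 1) = 1 by ring, ENNReal.rpow_one]
  gcongr
  exact sum_le_rpow_sum_rpow s _ hp0 hpr1

theorem eLpNorm_finset_le {p q : ℝ≥0∞} (hp : p ≠ 0) (hpq : 1 ≤ p⁻¹ + q⁻¹)
    (hp2 : 2⁻¹ ≤ p⁻¹) (s : Finset X) (c : X → ℂ) :
    eLpNorm (fun γ => ∑ x ∈ s, α.real {1} * c x * evalInv x γ) q (dualHaar α) ≤
      eLpNorm (Set.indicator (s : Set X) c) p α *
        dualHaar α Set.univ ^ (p⁻¹.toReal + q⁻¹.toReal - 1) := by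
  have hM0 : dualHaar α Set.univ ≠ 0 := by
    rw [dualHaar_univ]; simpa using measure_one_ne_top α
  have hM1 : dualHaar α Set.univ ≠ ∞ := measure_ne_top _ _
  have hple : p ≤ 2 := ENNReal.inv_le_inv.1 hp2
  have hp' : p ≠ ∞ := (hple.trans_lt (by simp)).ne
  have hp0 : 0 < p.toReal := ENNReal.toReal_pos hp hp'
  have hc : Continuous fun γ => ∑ x ∈ s, α.real {1} * c x * evalInv x γ := by fun_prop
  rw [ENNReal.toReal_inv, ENNReal.toReal_inv]
  rcases le_or_gt p 1 with h1 | h1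
  · refine (eLpNorm_le_eLpNorm_mul_rpow_measure_univ le_top hc.aestronglyMeasurable).trans ?_
    refine (mul_le_mul_left (eLpNorm_top_finset_le α hp h1 s c) _).trans_eq ?_
    rw [mul_assoc, ← ENNReal.rpow_add _ _ hM0 hM1]
    congr 2
    simp
    ring
  · have hpr1 : 1 < p.toReal := by
      simpa using (ENNReal.toReal_lt_toReal ENNReal.one_ne_top hp').2 h1
    have hpr := Real.HolderConjugate.conjExponent hpr1
    have hr0 := hpr.symm.pos
    have hp2' : p.toReal ≤ 2 := by simpa using ENNReal.toReal_mono (by simp) hple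
    have hinv := hpr.one_sub_inv
    set r := p.toReal.conjExponent with hr
    -- The hypothesis `1 ≤ 1/p + 1/q` says exactly that `q` is at most the conjugate exponent of
    -- `p`, so Hölder on the dual applies after Hausdorff–Young.
    have hqr : q ≤ ENNReal.ofReal r := by
      rw [← ENNReal.inv_le_inv, ← ENNReal.ofReal_inv_of_pos hr0, ← hinv,
        ENNReal.ofReal_sub _ (by positivity), ENNReal.ofReal_one, ENNReal.ofReal_inv_of_pos hp0,
        ENNReal.ofReal_toReal hp']
      exact tsub_le_iff_left.2 hpq
    refine (eLpNorm_le_eLpNorm_mul_rpow_measure_univ hqr hc.aestronglyMeasurable).trans ?_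
    refine (mul_le_mul_left (hausdorffYoung_finset α hpr hp2' s c) _).trans_eq ?_
    rw [ENNReal.ofReal_toReal hp', ENNReal.toReal_ofReal hr0.le, one_div, one_div, ← hinv]
    congr 2
    ring

/-- Finite truncations of `f` converge to it in `L²`, so by isometry their transforms converge in
`L²` and, along a subsequence, almost everywhere. Fatou carries the bound over, since truncation
does not increase the `L^p` norm. -/
theorem eLpNorm_fourierL2_le {p q : ℝ≥0∞} (hp : p ≠ 0) (hpq : 1 ≤ p⁻¹ + q⁻¹)
    (hp2 : 2⁻¹ ≤ p⁻¹) (f : Lp ℂ 2 α) :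
    eLpNorm (fourierL2 α f) q (dualHaar α) ≤
      eLpNorm f p α * dualHaar α Set.univ ^ (p⁻¹.toReal + q⁻¹.toReal - 1) := by
  have hs : ∀ n : ℕ, ∃ s : Finset X,
      eLpNorm ((s : Set X)ᶜ.indicator f) 2 α < ((n : ℝ≥0∞) + 1)⁻¹ := by
    intro n
    obtain ⟨s, -, hs, h⟩ := (Lp.memLp f).exists_eLpNorm_indicator_compl_lt (by simp)
      (ε := ((n : ℝ≥0∞) + 1)⁻¹) (by simp)
    have hfin : s.Finite := by
      by_contra hinf
      rw [discreteHaar_eq_smul_count α, Measure.smul_apply, Measure.count_apply_infinite hinf,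
        smul_eq_mul, ENNReal.mul_top (measure_one_ne_zero α)] at hs
      exact lt_irrefl _ hs
    obtain ⟨t, rfl⟩ := hfin.exists_finset_coe
    exact ⟨t, h⟩
  choose s hs using hs
  have hlim : Filter.Tendsto (fun n => finsuppL2 α (s n) f) Filter.atTop (nhds f) := by
    rw [Lp.tendsto_Lp_iff_tendsto_eLpNorm']
    have hz : Filter.Tendsto (fun n : ℕ => ((n : ℝ≥0∞) + 1)⁻¹) Filter.atTop (nhds 0) := by
      have := (Filter.tendsto_add_atTop_iff_nat 1).2 ENNReal.tendsto_inv_nat_nhds_zero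
      simpa using this
    refine tendsto_of_tendsto_of_tendsto_of_le_of_le tendsto_const_nhds hz
      (fun _ => bot_le) fun n => ?_
    refine le_of_eq_of_le ?_ (hs n).le
    rw [coe_finsuppL2, ← eLpNorm_neg]
    congr 1
    rw [neg_sub, sub_eq_iff_eq_add, Set.indicator_compl_add_self]
  have hlim2 := ((fourierL2 α).continuous.tendsto f).comp hlim
  rw [Lp.tendsto_Lp_iff_tendsto_eLpNorm'] at hlim2
  obtain ⟨ns, -, hae⟩ := (tendstoInMeasure_of_tendsto_eLpNorm two_ne_zero
    (fun n => (Lp.aestronglyMeasurable _)) (Lp.aestronglyMeasurable _)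
    hlim2).exists_seq_tendsto_ae
  refine Lp.eLpNorm_le_of_ae_tendsto (u := Filter.atTop)
    (f := fun i => (fourierL2 α (finsuppL2 α (s (ns i)) f) : PontryaginDual X → ℂ))
    (Filter.Eventually.of_forall fun n => ?_) (fun n => Lp.aestronglyMeasurable _) hae
  rw [eLpNorm_congr_ae (fourierL2_finsuppL2 α _ _)]
  refine (eLpNorm_finset_le α hp hpq hp2 _ _).trans ?_
  gcongr
  exact eLpNorm_indicator_le _

/-- Homogeneity, which lets test functions be used without normalizing them. -/
theorem eLpNorm_fourierL2_le_fourierNorm_mul {p q : ℝ≥0∞} (hp : p ≠ 0) {f : Lp ℂ 2 α}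
    (hf : MemLp f p α) :
    eLpNorm (fourierL2 α f) q (dualHaar α) ≤ fourierNorm α p q * eLpNorm f p α := by
  by_cases h0 : eLpNorm f p α = 0
  · rw [eLpNorm_eq_zero_iff (Lp.aestronglyMeasurable f) hp] at h0
    obtain rfl : f = 0 := Lp.ext (h0.trans (Lp.coeFn_zero ℂ 2 α).symm)
    rw [map_zero, eLpNorm_congr_ae (Lp.coeFn_zero ℂ 2 _), eLpNorm_zero]
    exact bot_le
  set N := eLpNorm f p α with hN
  have hNt : N ≠ ∞ := hf.2.ne
  set k : ℂ := ((N.toReal⁻¹ : ℝ) : ℂ) with hk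
  have hke : ‖k‖ₑ = N⁻¹ := by
    have hpos : 0 < N.toReal := ENNReal.toReal_pos h0 hNt
    rw [hk, ← ofReal_norm, Complex.norm_real, Real.norm_of_nonneg (by positivity),
      ENNReal.ofReal_inv_of_pos hpos, ENNReal.ofReal_toReal hNt]
  have hkf : ⇑(k • f) = k • ⇑f := ae_eq_discrete α (Lp.coeFn_smul k f)
  have h := le_iSup₂_of_le (f := fun (f : Lp ℂ 2 α) (_ : MemLp f p α) =>
    ⨆ (_ : eLpNorm f p α = 1), eLpNorm (fourierL2 α f) q (dualHaar α)) (k • f)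
    (by rw [hkf]; exact hf.const_smul k) (le_iSup_of_le (by
      rw [hkf, eLpNorm_const_smul, hke, ENNReal.inv_mul_cancel h0 hNt]) le_rfl)
  change _ ≤ fourierNorm α p q at h
  rw [map_smul, eLpNorm_congr_ae (Lp.coeFn_smul _ _), eLpNorm_const_smul, hke] at h
  calc _ = N⁻¹ * eLpNorm (fourierL2 α f) q (dualHaar α) * N := by
        rw [mul_right_comm, ENNReal.inv_mul_cancel h0 hNt, one_mul]
    _ ≤ _ := by gcongr

theorem eLpNorm_sum_evalInv_le_fourierNorm_mul {p q : ℝ≥0∞} (hp : p ≠ 0) (s : Finset X)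
    (c : X → ℂ) :
    eLpNorm (fun γ => ∑ x ∈ s, α.real {1} * c x * evalInv x γ) q (dualHaar α) ≤
      fourierNorm α p q * eLpNorm (Set.indicator (s : Set X) c) p α := by
  rw [← eLpNorm_congr_ae (fourierL2_finsuppL2 α s c)]
  rw [← coe_finsuppL2 α s c]
  refine eLpNorm_fourierL2_le_fourierNorm_mul α hp ?_
  rw [coe_finsuppL2]
  exact memLp_indicator_finset α s c p

theorem eLpNorm_indicator_const_finset {p : ℝ≥0∞} (hp : p ≠ 0) {s : Finset X} (hs : s.Nonempty)
    (k : ℂ) :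
    eLpNorm (Set.indicator (s : Set X) fun _ => k) p α =
      ‖k‖ₑ * (α {1} * s.card) ^ (1 / p.toReal) := by
  rw [eLpNorm_indicator_const' s.measurableSet _ hp, measure_finset]
  rw [measure_finset]
  simpa [measure_one_ne_zero α] using hs.ne_empty

theorem fourierNorm_eq {p q : ℝ≥0∞} (hp : p ≠ 0) (hq : q ≠ 0) (hpq : 1 ≤ p⁻¹ + q⁻¹)
    (hp2 : 2⁻¹ ≤ p⁻¹) :
    fourierNorm α p q = dualHaar α Set.univ ^ (p⁻¹.toReal + q⁻¹.toReal - 1) := by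
  have ha0 := measure_one_ne_zero α
  have ha1 := measure_one_ne_top α
  refine le_antisymm (iSup_le fun f => iSup₂_le fun _ hf => ?_) ?_
  · have := eLpNorm_fourierL2_le α hp hpq hp2 f
    rwa [hf, one_mul] at this
  -- The point mass at 1 is extremal: its norm is `a^(1/p)`, its transform is the constant `a` with
  -- norm `a M^(1/q)`, and `M = a⁻¹` turns the quotient into the claimed power.
  · have hn := eLpNorm_indicator_const_finset α hp (Finset.singleton_nonempty (1 : X)) 1
    have hn' : eLpNorm (Set.indicator (({1} : Finset X) : Set X) fun _ => (1 : ℂ)) p α =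
        α {1} ^ (1 / p.toReal) := by
      rw [hn]; simp
    have hne : α {1} ^ (1 / p.toReal) ≠ 0 := (ENNReal.rpow_pos (pos_iff_ne_zero.2 ha0) ha1).ne'
    have hnt : α {1} ^ (1 / p.toReal) ≠ ∞ :=
      ENNReal.rpow_ne_top_of_nonneg (by positivity) ha1
    have h := eLpNorm_sum_evalInv_le_fourierNorm_mul α (q := q) hp {1} (fun _ => 1)
    rw [hn'] at h
    have h1 : (fun γ : PontryaginDual X =>
        ∑ x ∈ ({1} : Finset X), (α.real {1} : ℂ) * 1 * evalInv x γ) = fun _ => (α.real {1} : ℂ) := by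
      funext γ
      simp [evalInv]
    have hr : ‖(α.real {1} : ℂ)‖ₑ = α {1} := by
      rw [← ofReal_norm, Complex.norm_real, Real.norm_of_nonneg (real_one_pos α).le, Measure.real,
        ENNReal.ofReal_toReal ha1]
    rw [h1, eLpNorm_const _ hq (NeZero.ne _), hr, ← ENNReal.div_le_iff hne hnt] at h
    refine le_of_eq_of_le ?_ h
    rw [dualHaar_univ, ENNReal.toReal_inv, ENNReal.toReal_inv, ENNReal.inv_rpow,
      ENNReal.inv_rpow, ← ENNReal.rpow_neg, ← ENNReal.rpow_neg, div_eq_mul_inv,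
      ← ENNReal.rpow_neg]
    nth_rewrite 2 [← ENNReal.rpow_one (α {1})]
    rw [← ENNReal.rpow_add _ _ ha0 ha1, ← ENNReal.rpow_add _ _ ha0 ha1]
    congr 1
    simp only [one_div]
    ring

end Finite

/-! ### Finite sets with few quotients, and their representation counts. -/

section Combinatorics

/-- In a torsion group, finitely generated subgroups are finite and serve as both `A` and `D`.
Otherwise an element of infinite order gives a geometric progression of length `n`, with at most `2n
- 1` quotients. -/
theorem exists_finset_small_doubling (X : Type*) [CommGroup X] [Infinite X] (n : ℕ) :
    ∃ A D : Finset X, n ≤ A.card ∧ D.card ≤ 2 * A.card ∧ ∀ x ∈ A, ∀ y ∈ A, x * y⁻¹ ∈ D := by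
  classical
  by_cases h : IsMulTorsion X
  · obtain ⟨s, hs⟩ := Infinite.exists_subset_card_eq X n
    have hfg : Group.FG (Subgroup.closure (s : Set X)) := inferInstance
    have hfin : Finite (Subgroup.closure (s : Set X)) :=
      CommGroup.finite_of_fg_isMulTorsion _ (h.subgroup _)
    have hf : (Subgroup.closure (s : Set X) : Set X).Finite := hfin
    refine ⟨hf.toFinset, hf.toFinset, ?_, by omega, fun x hx y hy => ?_⟩
    · rw [← hs]
      refine Finset.card_le_card fun x hx => ?_
      simpa using Subgroup.subset_closure (by exact_mod_cast hx)
    · simp only [Set.Finite.mem_toFinset, SetLike.mem_coe] at hx hy ⊢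
      exact mul_mem hx (inv_mem hy)
  · obtain ⟨x, hx⟩ : ∃ x : X, ¬ IsOfFinOrder x := by
      simpa [IsMulTorsion] using h
    have hinj : Function.Injective fun k : ℤ => x ^ k := injective_zpow_iff_not_isOfFinOrder.2 hx
    refine ⟨(Finset.Ico (0 : ℤ) n).image fun k : ℤ => x ^ k,
      (Finset.Ioo (-n : ℤ) n).image fun k : ℤ => x ^ k, ?_, ?_, ?_⟩
    · rw [Finset.card_image_of_injective _ hinj]; simp
    · rw [Finset.card_image_of_injective _ hinj, Finset.card_image_of_injective _ hinj]
      simp only [Int.card_Ioo, Int.card_Ico]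
      omega
    · simp only [Finset.mem_image, Finset.mem_Ico, Finset.mem_Ioo]
      rintro _ ⟨i, hi, rfl⟩ _ ⟨j, hj, rfl⟩
      exact ⟨i - j, by omega, by rw [zpow_sub]⟩

theorem exists_forall_mul_rpow_lt (K : ℝ) {c u v : ℝ} (hc : 0 < c) (huv : u < v) :
    ∃ n₀ : ℕ, 0 < n₀ ∧ ∀ N : ℕ, n₀ ≤ N → K * (N : ℝ) ^ u < c * (N : ℝ) ^ v := by
  have h := ((tendsto_rpow_atTop (sub_pos.2 huv)).comp
    (tendsto_natCast_atTop_atTop (R := ℝ))).eventually_gt_atTop (K / c)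
  obtain ⟨n₀, hn⟩ := Filter.eventually_atTop.1 h
  refine ⟨n₀ + 1, by omega, fun N hN => ?_⟩
  have hN0 : (0 : ℝ) < N := by exact_mod_cast (by omega : 0 < N)
  have := hn N (by omega)
  simp only [Function.comp] at this
  rw [div_lt_iff₀ hc] at this
  calc K * (N : ℝ) ^ u < (N : ℝ) ^ (v - u) * c * (N : ℝ) ^ u := by gcongr
    _ = c * (N : ℝ) ^ v := by
      rw [mul_right_comm, ← Real.rpow_add hN0, mul_comm, sub_add_cancel]

variable {X : Type*} [CommGroup X]

/-- The number of representations of `z` as a quotient of two elements of `A`. -/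
noncomputable def quotientCount (A : Finset X) (z : X) : ℕ :=
  open Classical in ((A ×ˢ A).filter fun w => w.1 * w.2⁻¹ = z).card

theorem quotientCount_le (A : Finset X) (z : X) : quotientCount A z ≤ A.card := by
  classical
  refine Finset.card_le_card_of_injOn Prod.fst (fun w hw => ?_) fun w hw w' hw' h => ?_
  · simp only [Finset.coe_filter, Finset.mem_product, Set.mem_ofPred_eq] at hw
    exact hw.1.1
  · simp only [Finset.coe_filter, Finset.mem_product, Set.mem_ofPred_eq] at hw hw'
    refine Prod.ext h ?_
    have := hw.2.trans hw'.2.symm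
    rw [h] at this
    exact inv_injective (mul_left_cancel this)

/-- Cauchy–Schwarz over `D`: the counts add up to `|A|²` and are spread over at most `2|A|`
elements. -/
theorem card_pow_three_le_sum_sq {A D : Finset X} (hD : ∀ x ∈ A, ∀ y ∈ A, x * y⁻¹ ∈ D)
    (hcard : D.card ≤ 2 * A.card) (hA : 0 < A.card) :
    (A.card : ℝ) ^ 3 / 2 ≤ ∑ z ∈ D, (quotientCount A z : ℝ) ^ 2 := by
  classical
  have h1 : ∑ z ∈ D, quotientCount A z = A.card ^ 2 := by
    have := Finset.card_eq_sum_card_fiberwise (s := A ×ˢ A) (t := D) (f := fun w => w.1 * w.2⁻¹)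
      fun w hw => hD _ (Finset.mem_product.1 hw).1 _ (Finset.mem_product.1 hw).2
    rw [Finset.card_product] at this
    rw [sq, this]
    refine Finset.sum_congr rfl fun z _ => ?_
    unfold quotientCount
    congr!
  have h2 := sq_sum_le_card_mul_sum_sq (s := D) (f := fun z => (quotientCount A z : ℝ))
  have h3 : ∑ z ∈ D, (quotientCount A z : ℝ) = (A.card : ℝ) ^ 2 := by exact_mod_cast h1
  rw [h3] at h2
  have hN : (0 : ℝ) < A.card := by exact_mod_cast hA
  have hD' : (D.card : ℝ) ≤ 2 * A.card := by exact_mod_cast hcard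
  set S := ∑ z ∈ D, (quotientCount A z : ℝ) ^ 2
  have hS : 0 ≤ S := Finset.sum_nonneg fun _ _ => by positivity
  have h4 : ((A.card : ℝ) ^ 2) ^ 2 ≤ 2 * A.card * S := h2.trans (by gcongr)
  have h5 : (A.card : ℝ) * ((A.card : ℝ) ^ 3 / 2) ≤ A.card * S := by nlinarith
  exact le_of_mul_le_mul_left h5 hN

end Combinatorics

/-! ### Lower bounds for a moment from two other moments. -/

section Moments

/-- A pointwise inequality integrated: for `h ≤ t` the left integrand is nonpositive, and for `h >
t` one has `h^q ≥ t^(q - 2) h²`. -/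
theorem le_integral_rpow_of_two_lt {Ω : Type*} [MeasurableSpace Ω] {ν : Measure Ω}
    {h : Ω → ℝ} (h0 : ∀ ω, 0 ≤ h ω) {q t : ℝ} (hq : 2 < q) (ht : 0 < t) (h1 : Integrable h ν)
    (h2 : Integrable (fun ω => h ω ^ 2) ν) (h3 : Integrable (fun ω => h ω ^ q) ν) :
    t ^ (q - 2) * (∫ ω, h ω ^ 2 ∂ν - t * ∫ ω, h ω ∂ν) ≤ ∫ ω, h ω ^ q ∂ν := by
  rw [← integral_const_mul, ← integral_sub h2 (h1.const_mul t), ← integral_const_mul]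
  refine integral_mono ((h2.sub (h1.const_mul t)).const_mul _) h3 fun ω => ?_
  change t ^ (q - 2) * (h ω ^ 2 - t * h ω) ≤ h ω ^ q
  rcases le_or_gt (h ω) t with h4 | h4
  · refine le_trans ?_ (Real.rpow_nonneg (h0 ω) q)
    refine mul_nonpos_of_nonneg_of_nonpos (by positivity) ?_
    nlinarith [h0 ω]
  · have hpos : 0 < h ω := ht.trans h4
    calc t ^ (q - 2) * (h ω ^ 2 - t * h ω) ≤ h ω ^ (q - 2) * h ω ^ 2 := by
          have h5 : t ^ (q - 2) ≤ h ω ^ (q - 2) := Real.rpow_le_rpow ht.le h4.le (by linarith)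
          have h6 : h ω ^ 2 - t * h ω ≤ h ω ^ 2 := by nlinarith
          calc _ ≤ t ^ (q - 2) * h ω ^ 2 := by gcongr
            _ ≤ _ := by gcongr
      _ = h ω ^ q := by
          rw [← Real.rpow_natCast, ← Real.rpow_add hpos]
          congr 1
          push_cast
          ring

/-- Here the roles are reversed: `h^q ≥ t^(q - 2) h²` holds for `h ≤ t`, and the fourth-power
correction makes the left integrand nonpositive for `h > t`. -/
theorem le_integral_rpow_of_le_two {Ω : Type*} [MeasurableSpace Ω] {ν : Measure Ω}
    {h : Ω → ℝ} (h0 : ∀ ω, 0 ≤ h ω) {q t : ℝ} (hq0 : 0 < q) (hq : q ≤ 2) (ht : 0 < t)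
    (h2 : Integrable (fun ω => h ω ^ 2) ν) (h3 : Integrable (fun ω => h ω ^ q) ν)
    (h4 : Integrable (fun ω => h ω ^ 4) ν) :
    t ^ (q - 2) * (∫ ω, h ω ^ 2 ∂ν - (t ^ 2)⁻¹ * ∫ ω, h ω ^ 4 ∂ν) ≤ ∫ ω, h ω ^ q ∂ν := by
  rw [← integral_const_mul, ← integral_sub h2 (h4.const_mul _), ← integral_const_mul]
  refine integral_mono ((h2.sub (h4.const_mul _)).const_mul _) h3 fun ω => ?_
  change t ^ (q - 2) * (h ω ^ 2 - (t ^ 2)⁻¹ * h ω ^ 4) ≤ h ω ^ q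
  have hsq : h ω ^ 2 - (t ^ 2)⁻¹ * h ω ^ 4 = h ω ^ 2 * ((t ^ 2)⁻¹ * (t ^ 2 - h ω ^ 2)) := by
    field_simp
  rcases le_or_gt (h ω) t with h5 | h5
  · rcases (h0 ω).eq_or_lt with h6 | hpos
    · rw [← h6]
      simp [Real.zero_rpow hq0.ne']
    calc t ^ (q - 2) * (h ω ^ 2 - (t ^ 2)⁻¹ * h ω ^ 4) ≤ h ω ^ (q - 2) * h ω ^ 2 := by
          have h7 : t ^ (q - 2) ≤ h ω ^ (q - 2) :=
            Real.rpow_le_rpow_of_nonpos hpos h5 (by linarith)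
          have h8 : h ω ^ 2 - (t ^ 2)⁻¹ * h ω ^ 4 ≤ h ω ^ 2 := by
            have : 0 ≤ (t ^ 2)⁻¹ * h ω ^ 4 := by positivity
            linarith
          calc _ ≤ t ^ (q - 2) * h ω ^ 2 := by gcongr
            _ ≤ _ := by gcongr
      _ = h ω ^ q := by
          rw [← Real.rpow_natCast, ← Real.rpow_add hpos]
          congr 1
          push_cast
          ring
  · refine le_trans ?_ (Real.rpow_nonneg (h0 ω) q)
    refine mul_nonpos_of_nonneg_of_nonpos (by positivity) ?_
    rw [hsq]
    refine mul_nonpos_of_nonneg_of_nonpos (by positivity)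
      (mul_nonpos_of_nonneg_of_nonpos (by positivity) ?_)
    nlinarith

end Moments

/-! ### Products of characters and the transform of the representation count. -/

section Characters

variable {X : Type*} [CommGroup X] [TopologicalSpace X]

theorem evalInv_mul_inv (x y : X) (γ : PontryaginDual X) :
    evalInv (x * y⁻¹) γ = evalInv x γ * conj (evalInv y γ) := by
  change (γ (x * y⁻¹)⁻¹ : ℂ) = (γ x⁻¹ : ℂ) * conj (γ y⁻¹ : ℂ)
  rw [← Circle.coe_inv_eq_conj, ← map_inv, ← Circle.coe_mul, ← map_mul, mul_inv]

theorem evalInv_mul (x y : X) (γ : PontryaginDual X) :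
    evalInv (x * y) γ = evalInv x γ * evalInv y γ := by
  change (γ (x * y)⁻¹ : ℂ) = (γ x⁻¹ : ℂ) * (γ y⁻¹ : ℂ)
  rw [← Circle.coe_mul, ← map_mul, mul_inv]

theorem sum_quotientCount_mul_evalInv {A D : Finset X} (hD : ∀ x ∈ A, ∀ y ∈ A, x * y⁻¹ ∈ D)
    (γ : PontryaginDual X) :
    ∑ z ∈ D, (quotientCount A z : ℂ) * evalInv z γ = ((‖∑ x ∈ A, evalInv x γ‖ ^ 2 : ℝ) : ℂ) := by
  classical
  have h1 : ∀ z, (quotientCount A z : ℂ) * evalInv z γ =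
      ∑ w ∈ A ×ˢ A with w.1 * w.2⁻¹ = z, evalInv (w.1 * w.2⁻¹) γ := fun z => by
    rw [Finset.sum_congr rfl (g := fun _ => evalInv z γ) fun w hw => by
      rw [(Finset.mem_filter.1 hw).2], Finset.sum_const, nsmul_eq_mul]
    congr!
  simp_rw [h1]
  rw [Finset.sum_fiberwise_of_maps_to fun w hw =>
    hD _ (Finset.mem_product.1 hw).1 _ (Finset.mem_product.1 hw).2]
  simp_rw [evalInv_mul_inv]
  rw [Complex.ofReal_pow, ← Complex.mul_conj', map_sum, Finset.sum_mul_sum, Finset.sum_product]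

variable [DiscreteTopology X]

theorem integral_evalInv_mul_conj (ν : Measure (PontryaginDual X)) [ν.IsMulLeftInvariant]
    {z y : X} (h : z ≠ y) : ∫ γ, evalInv z γ * conj (evalInv y γ) ∂ν = 0 := by
  simp_rw [← evalInv_mul_inv]
  exact integral_eval ν (by simpa [mul_inv_eq_one] using h.symm)

end Characters

/-! ### Test functions showing that the norm is infinite. -/

section Unbounded

variable {X : Type*} [CommGroup X] [TopologicalSpace X] [DiscreteTopology X]
  [MeasurableSpace X] [BorelSpace X] (α : Measure X) [α.IsHaarMeasure]

/-- The dual has finite mass, so `L^q` embeds in `L^q'`. This reduces `q = ∞` to finite exponents.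
-/
theorem fourierNorm_ne_top_of_le {p q q' : ℝ≥0∞} (hqq : q' ≤ q)
    (h : fourierNorm α p q ≠ ∞) : fourierNorm α p q' ≠ ∞ := by
  have hb : (dualHaar α) Set.univ ^ (1 / q'.toReal - 1 / q.toReal) ≠ ∞ := by
    have hM0 : dualHaar α Set.univ ≠ 0 := by
      rw [dualHaar_univ]; simpa using measure_one_ne_top α
    exact ENNReal.rpow_ne_top_of_ne_zero hM0 (measure_ne_top _ _)
  refine ne_top_of_le_ne_top (ENNReal.mul_ne_top h hb)
    (iSup_le fun f => iSup₂_le fun hf hf1 => ?_)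
  refine (eLpNorm_le_eLpNorm_mul_rpow_measure_univ hqq (Lp.aestronglyMeasurable _)).trans ?_
  gcongr
  exact le_iSup₂_of_le f hf (le_iSup_of_le hf1 le_rfl)

theorem mul_integral_rpow_le_of_fourierNorm_ne_top {p q : ℝ≥0∞} (hp : p ≠ 0) (hq : q ≠ 0)
    (hq' : q ≠ ∞) (h : fourierNorm α p q ≠ ∞) {s : Finset X} (hs : s.Nonempty) (c : X → ℂ)
    {B : ℝ} (hB : 0 ≤ B) (hc : ∀ x, ‖c x‖ ≤ B) :
    α.real {1} * (∫ γ, ‖∑ x ∈ s, c x * evalInv x γ‖ ^ q.toReal ∂(dualHaar α)) ^ (1 / q.toReal) ≤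
      (fourierNorm α p q).toReal * (B * (α.real {1} * s.card) ^ (1 / p.toReal)) := by
  have ha := real_one_pos α
  have hcont : Continuous fun γ => ∑ x ∈ s, c x * evalInv x γ := by fun_prop
  have hm : MemLp (fun γ => ∑ x ∈ s, c x * evalInv x γ) q (dualHaar α) :=
    MemLp.of_bound hcont.aestronglyMeasurable (∑ x ∈ s, ‖c x‖)
      (Filter.Eventually.of_forall fun γ => (norm_sum_le _ _).trans
        (Finset.sum_le_sum fun x _ => by rw [norm_mul, norm_evalInv_apply, mul_one]))
  have h1 := eLpNorm_sum_evalInv_le_fourierNorm_mul α (q := q) hp s c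
  have h2 : (fun γ => ∑ x ∈ s, (α.real {1} : ℂ) * c x * evalInv x γ) =
      (α.real {1} : ℂ) • fun γ => ∑ x ∈ s, c x * evalInv x γ := by
    funext γ
    simp [Finset.mul_sum, mul_assoc]
  have h3 : eLpNorm (Set.indicator (s : Set X) c) p α ≤
      ENNReal.ofReal (B * (α.real {1} * s.card) ^ (1 / p.toReal)) := by
    have h4 : eLpNorm (Set.indicator (s : Set X) c) p α ≤
        eLpNorm (Set.indicator (s : Set X) fun _ => (B : ℂ)) p α := by
      refine eLpNorm_mono fun x => ?_
      by_cases hx : x ∈ (s : Set X)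
      · simpa [hx, abs_of_nonneg hB] using hc x
      · simp [hx]
    refine h4.trans_eq ?_
    rw [eLpNorm_indicator_const_finset α hp hs, ENNReal.ofReal_mul hB, ← ofReal_norm,
      Complex.norm_real, Real.norm_of_nonneg hB,
      ← ENNReal.ofReal_rpow_of_nonneg (by positivity) (by positivity), ENNReal.ofReal_mul ha.le,
      Measure.real, ENNReal.ofReal_toReal (measure_one_ne_top α), ENNReal.ofReal_natCast]
  rw [h2, eLpNorm_const_smul, hm.eLpNorm_eq_integral_rpow_norm hq hq', ← ofReal_norm,
    Complex.norm_real, Real.norm_of_nonneg ha.le, ← ENNReal.ofReal_mul ha.le, ← one_div] at h1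
  have h5 := h1.trans (mul_le_mul_right h3 _)
  rw [← ENNReal.ofReal_toReal h, ← ENNReal.ofReal_mul ENNReal.toReal_nonneg] at h5
  exact (ENNReal.ofReal_le_ofReal_iff (by positivity)).1 h5

theorem fourierNorm_eq_top_of_two_lt [Infinite X] {p q : ℝ≥0∞} (hp : p ≠ 0) (hq' : q ≠ ∞)
    (hq2 : 2 < q.toReal) (hpq : 1 / p.toReal + 1 / q.toReal < 1) :
    fourierNorm α p q = ∞ := by
  by_contra htop
  have hq0 : q ≠ 0 := by rintro rfl; simp at hq2; linarith
  set r := q.toReal with hr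
  have hr0 : 0 < r := by linarith
  -- For `p = ∞` this is `1 / 0 = 0`, in agreement with the convention `1/∞ = 0`.
  set P := 1 / p.toReal with hP
  have hP0 : 0 ≤ P := by positivity
  set a := α.real {1} with ha_def
  set M := (dualHaar α).real Set.univ with hM_def
  have ha : 0 < a := real_one_pos α
  have haM : a * M = 1 := real_one_mul_dualHaar_real_univ α
  have hM : 0 < M := pos_of_mul_pos_right (haM.symm ▸ one_pos) ha.le
  set K := (fourierNorm α p q).toReal with hK
  have hK0 : 0 ≤ K := ENNReal.toReal_nonneg
  set c : ℝ := a * ((1 / 4 : ℝ) ^ (r - 2) * (M / 4)) ^ (1 / r) with hc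
  obtain ⟨n₀, hn₀, hn⟩ := exists_forall_mul_rpow_lt (K * (a * 2) ^ P) (c := c) (u := 1 + P)
    (v := 2 - 1 / r) (by positivity) (by linarith)
  obtain ⟨A, D, hA, hcard, hD⟩ := exists_finset_small_doubling X n₀
  have hApos : 0 < A.card := by omega
  have hN : (0 : ℝ) < A.card := by exact_mod_cast hApos
  obtain ⟨x₀, hx₀⟩ := Finset.card_pos.1 hApos
  have hDne : D.Nonempty := ⟨_, hD _ hx₀ _ hx₀⟩
  have hup := mul_integral_rpow_le_of_fourierNorm_ne_top α hp hq0 hq' htop hDne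
    (fun z => (quotientCount A z : ℂ)) (B := A.card) hN.le fun z => by
      simpa using quotientCount_le A z
  simp_rw [sum_quotientCount_mul_evalInv hD] at hup
  have hcP : Continuous fun γ => ∑ x ∈ A, evalInv x γ := by fun_prop
  have hint2 : ∫ γ, ‖∑ x ∈ A, evalInv x γ‖ ^ 2 ∂(dualHaar α) = M * A.card := by
    have := integral_norm_sq_sum_evalInv (dualHaar α) A fun _ => 1
    simpa using this
  have hint4 : M * ((A.card : ℝ) ^ 3 / 2) ≤
      ∫ γ, (‖∑ x ∈ A, evalInv x γ‖ ^ 2) ^ 2 ∂(dualHaar α) := by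
    have := integral_norm_sq_sum_evalInv (dualHaar α) D fun z => (quotientCount A z : ℂ)
    simp_rw [sum_quotientCount_mul_evalInv hD, Complex.norm_real, norm_pow, norm_norm,
      Complex.norm_natCast] at this
    rw [this]
    gcongr
    exact card_pow_three_le_sum_sq hD hcard hApos
  -- With `h = |P|²` one has `∫ h = M N` and `∫ h² ≥ M N³ / 2`; the threshold `N²/4` makes the
  -- subtracted term `M N³ / 4`, half of the latter.
  have hlow := le_integral_rpow_of_two_lt (ν := dualHaar α)
    (h := fun γ => ‖∑ x ∈ A, evalInv x γ‖ ^ 2) (fun _ => by positivity) (q := r)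
    (t := (A.card : ℝ) ^ 2 / 4) hq2 (by positivity)
    (integrable_of_continuous (by fun_prop)) (integrable_of_continuous (by fun_prop))
    (integrable_of_continuous (Continuous.rpow_const (by fun_prop) fun _ => Or.inr hr0.le))
  rw [hint2] at hlow
  simp_rw [Complex.norm_real, norm_pow, norm_norm] at hup
  set I := ∫ γ, (‖∑ x ∈ A, evalInv x γ‖ ^ 2) ^ r ∂(dualHaar α) with hI
  have hlow2 : (1 / 4 : ℝ) ^ (r - 2) * (M / 4) * (A.card : ℝ) ^ (2 * r - 1) ≤ I := by
    refine le_trans ?_ hlow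
    have e1 : ((A.card : ℝ) ^ 2 / 4) ^ (r - 2) = (1 / 4 : ℝ) ^ (r - 2) *
        (A.card : ℝ) ^ (2 * (r - 2)) := by
      rw [div_eq_mul_one_div, Real.mul_rpow (by positivity) (by positivity), mul_comm,
        Real.rpow_mul hN.le, Real.rpow_two]
    have e2 : (A.card : ℝ) ^ (2 * r - 1) = (A.card : ℝ) ^ (2 * (r - 2)) * (A.card : ℝ) ^ 3 := by
      rw [← Real.rpow_natCast, ← Real.rpow_add hN]
      congr 1
      push_cast
      ring
    rw [e1, e2]
    have : M * (A.card : ℝ) ^ 3 / 4 ≤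
      ∫ γ, (‖∑ x ∈ A, evalInv x γ‖ ^ 2) ^ 2 ∂(dualHaar α) -
        (A.card : ℝ) ^ 2 / 4 * (M * A.card) := by nlinarith
    calc _ = (1 / 4 : ℝ) ^ (r - 2) * (A.card : ℝ) ^ (2 * (r - 2)) *
          (M * (A.card : ℝ) ^ 3 / 4) := by ring
      _ ≤ _ := by gcongr
  refine absurd ((hn A.card hA).trans_le ?_) (lt_irrefl _)
  calc c * (A.card : ℝ) ^ (2 - 1 / r)
      = a * ((1 / 4 : ℝ) ^ (r - 2) * (M / 4) * (A.card : ℝ) ^ (2 * r - 1)) ^ (1 / r) := by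
        rw [Real.mul_rpow (by positivity) (by positivity), ← Real.rpow_mul hN.le, hc]
        have : (2 * r - 1) * (1 / r) = 2 - 1 / r := by field_simp
        rw [this, mul_assoc]
    _ ≤ a * I ^ (1 / r) := by gcongr
    _ ≤ K * (A.card * (a * D.card) ^ P) := hup
    _ ≤ K * (A.card * (a * (2 * A.card)) ^ P) := by
        gcongr
        exact_mod_cast hcard
    _ = K * (a * 2) ^ P * (A.card : ℝ) ^ (1 + P) := by
        rw [← mul_assoc a, Real.mul_rpow (by positivity) hN.le, Real.rpow_add hN, Real.rpow_one]
        ring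

/-- Any infinite group contains arbitrarily large finite sets with the fourth moment of a
Sidon set. -/
theorem exists_finset_integral_pow_four_le [Infinite X] (n : ℕ) :
    ∃ A : Finset X, A.card = n ∧
      ∫ γ, ‖∑ x ∈ A, evalInv x γ‖ ^ 4 ∂(dualHaar α) ≤
        3 * (dualHaar α).real Set.univ * (n : ℝ) ^ 2 := by
  classical
  induction n with
  | zero => exact ⟨∅, by simp, by simp⟩
  | succ n ih =>
    obtain ⟨A, hA, h4⟩ := ih
    set ν := dualHaar α with hν
    set M := ν.real Set.univ with hM
    -- A new point outside `A` and `A A⁻¹ A`: then the character at `y` is orthogonal to `F` and to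
    -- `|F|² F`, so the term linear in `V` below integrates to zero.
    obtain ⟨y, hy⟩ := Infinite.exists_notMem_finset
      (A ∪ (A ×ˢ A ×ˢ A).image fun w => w.1 * w.2.1⁻¹ * w.2.2)
    rw [Finset.mem_union, not_or] at hy
    obtain ⟨hyA, hy3⟩ := hy
    refine ⟨insert y A, by rw [Finset.card_insert_of_notMem hyA, hA], ?_⟩
    let F : PontryaginDual X → ℂ := fun γ => ∑ x ∈ A, evalInv x γ
    have hF : Continuous F := by fun_prop
    let V : PontryaginDual X → ℝ := fun γ => (F γ * conj (evalInv y γ)).re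
    have hV : Continuous V := by fun_prop
    have hexp : ∀ γ, ‖∑ x ∈ insert y A, evalInv x γ‖ ^ 4 =
        ‖F γ‖ ^ 4 + 2 * ‖F γ‖ ^ 2 + 1 + 4 * ((‖F γ‖ ^ 2 + 1) * V γ) + 4 * V γ ^ 2 := by
      intro γ
      rw [Finset.sum_insert hyA, add_comm]
      change ‖F γ + evalInv y γ‖ ^ 4 = _
      have h1 : ‖F γ + evalInv y γ‖ ^ 2 = ‖F γ‖ ^ 2 + 1 + 2 * V γ := by
        rw [Complex.sq_norm, Complex.normSq_add, ← Complex.sq_norm, ← Complex.sq_norm,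
          norm_evalInv_apply, one_pow]
      rw [show ‖F γ + evalInv y γ‖ ^ 4 = (‖F γ + evalInv y γ‖ ^ 2) ^ 2 by ring, h1]
      ring
    have hF2 : ∫ γ, ‖F γ‖ ^ 2 ∂ν = M * n := by
      have := integral_norm_sq_sum_evalInv ν A fun _ => 1
      simpa [hA] using this
    have hV2 : ∫ γ, V γ ^ 2 ∂ν ≤ M * n := by
      rw [← hF2]
      refine integral_mono (integrable_of_continuous (by fun_prop))
        (integrable_of_continuous (by fun_prop)) fun γ => ?_
      have := Complex.abs_re_le_norm (F γ * conj (evalInv y γ))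
      rw [norm_mul, RCLike.norm_conj, norm_evalInv_apply, mul_one] at this
      exact sq_le_sq' (by linarith [neg_abs_le (V γ)]) ((le_abs_self _).trans this)
    have hUV : ∫ γ, (‖F γ‖ ^ 2 + 1) * V γ ∂ν = 0 := by
      have hz1 : ∫ γ, F γ * conj (evalInv y γ) ∂ν = 0 := by
        simp only [F, Finset.sum_mul]
        rw [integral_finsetSum _ fun x _ => integrable_of_continuous (by fun_prop)]
        refine Finset.sum_eq_zero fun x hx => integral_evalInv_mul_conj ν ?_
        rintro rfl
        exact hyA hx
      have hz3 : ∫ γ, (F γ * conj (F γ) * F γ) * conj (evalInv y γ) ∂ν = 0 := by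
        have : ∀ γ, F γ * conj (F γ) * F γ * conj (evalInv y γ) =
            ∑ w ∈ A ×ˢ A ×ˢ A, evalInv (w.1 * w.2.1⁻¹ * w.2.2) γ * conj (evalInv y γ) := by
          intro γ
          simp_rw [evalInv_mul _ (Prod.snd _), evalInv_mul_inv]
          simp only [F, map_sum, Finset.sum_product, Finset.sum_mul, Finset.mul_sum]
          refine (Finset.sum_congr rfl fun x _ => Finset.sum_comm).trans ?_
          rw [Finset.sum_comm]
          exact Finset.sum_congr rfl fun x _ => Finset.sum_comm
        simp_rw [this]
        rw [integral_finsetSum _ fun x _ => integrable_of_continuous (by fun_prop)]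
        refine Finset.sum_eq_zero fun w hw => integral_evalInv_mul_conj ν ?_
        intro h
        exact hy3 (Finset.mem_image.2 ⟨w, hw, h⟩)
      have hsum : ∀ γ, (((‖F γ‖ ^ 2 + 1) * V γ : ℝ)) =
          ((F γ * conj (F γ) * F γ) * conj (evalInv y γ) + F γ * conj (evalInv y γ)).re := by
        intro γ
        have : (F γ * conj (F γ) * F γ) * conj (evalInv y γ) + F γ * conj (evalInv y γ) =
            ((‖F γ‖ ^ 2 + 1 : ℝ) : ℂ) * (F γ * conj (evalInv y γ)) := by
          rw [Complex.mul_conj']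
          push_cast
          ring
        rw [this, Complex.re_ofReal_mul]
      simp_rw [hsum]
      have hi1 : Integrable (fun γ => (F γ * conj (F γ) * F γ) * conj (evalInv y γ)) ν :=
        integrable_of_continuous (by fun_prop)
      have hi2 : Integrable (fun γ => F γ * conj (evalInv y γ)) ν :=
        integrable_of_continuous (by fun_prop)
      have hre := integral_re (𝕜 := ℂ) (hi1.add hi2)
      simp only [Pi.add_apply, integral_add hi1 hi2, hz1, hz3, RCLike.re_to_complex] at hre
      simpa using hre
    simp_rw [hexp]
    have hi : ∀ f : PontryaginDual X → ℝ, Continuous f → Integrable f ν := fun f hf =>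
      integrable_of_continuous hf
    rw [integral_add (hi _ (by fun_prop)) (hi _ (by fun_prop)),
      integral_add (hi _ (by fun_prop)) (hi _ (by fun_prop)),
      integral_add (hi _ (by fun_prop)) (hi _ (by fun_prop)),
      integral_add (hi _ (by fun_prop)) (hi _ (by fun_prop)),
      integral_const_mul, integral_const_mul, integral_const_mul, hUV, hF2]
    change ∫ γ, ‖F γ‖ ^ 4 ∂ν ≤ _ at h4
    have hc : ∫ _ : PontryaginDual X, (1 : ℝ) ∂ν = M := by simp [hM]
    have hM0 : 0 ≤ M := measureReal_nonneg
    rw [hc]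
    -- The fourth moment grows by at most `2Mn + M + 4Mn`, below the increment `3M(2n + 1)` of the
    -- bound.
    push_cast
    nlinarith

theorem fourierNorm_eq_top_of_le_two [Infinite X] {p q : ℝ≥0∞} (hp : p ≠ 0) (hq0 : q ≠ 0)
    (hq2 : q ≤ 2) (hp2 : 1 / p.toReal < 1 / 2) :
    fourierNorm α p q = ∞ := by
  by_contra htop
  have hq' : q ≠ ∞ := (hq2.trans_lt (by simp)).ne
  set r := q.toReal with hr
  have hr0 : 0 < r := ENNReal.toReal_pos hq0 hq'
  have hr2 : r ≤ 2 := by simpa using ENNReal.toReal_mono (by simp) hq2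
  set P := 1 / p.toReal with hP
  have hP0 : 0 ≤ P := by positivity
  set a := α.real {1} with ha_def
  set M := (dualHaar α).real Set.univ with hM_def
  have ha : 0 < a := real_one_pos α
  have haM : a * M = 1 := real_one_mul_dualHaar_real_univ α
  have hM : 0 < M := pos_of_mul_pos_right (haM.symm ▸ one_pos) ha.le
  set K := (fourierNorm α p q).toReal with hK
  set c : ℝ := a * ((6 : ℝ) ^ ((r - 2) / 2) * (M / 2)) ^ (1 / r) with hc
  obtain ⟨n, hn₀, hn⟩ := exists_forall_mul_rpow_lt (K * a ^ P) (c := c) (u := P)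
    (v := 1 / 2) (by positivity) hp2
  obtain ⟨A, rfl, h4⟩ := exists_finset_integral_pow_four_le α n
  have hN : (0 : ℝ) < A.card := by exact_mod_cast hn₀
  have hup := mul_integral_rpow_le_of_fourierNorm_ne_top α hp hq0 hq' htop
    (Finset.card_pos.1 hn₀) (fun _ => 1) (B := 1) zero_le_one fun z => by simp
  simp only [one_mul] at hup
  have hcP : Continuous fun γ => ∑ x ∈ A, evalInv x γ := by fun_prop
  have hint2 : ∫ γ, ‖∑ x ∈ A, evalInv x γ‖ ^ 2 ∂(dualHaar α) = M * A.card := by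
    have := integral_norm_sq_sum_evalInv (dualHaar α) A fun _ => 1
    simpa using this
  -- With `t² = 6N` the fourth-moment correction is at most `3MN² / (6N)`, half of the second moment
  -- `MN`.
  have hlow := le_integral_rpow_of_le_two (ν := dualHaar α)
    (h := fun γ => ‖∑ x ∈ A, evalInv x γ‖) (fun _ => by positivity) (q := r)
    (t := √(6 * A.card)) hr0 hr2 (by positivity)
    (integrable_of_continuous (by fun_prop))
    (integrable_of_continuous (Continuous.rpow_const (by fun_prop) fun _ => Or.inr hr0.le))
    (integrable_of_continuous (by fun_prop))
  rw [hint2, Real.sq_sqrt (by positivity)] at hlow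
  set I := ∫ γ, ‖∑ x ∈ A, evalInv x γ‖ ^ r ∂(dualHaar α) with hI
  have hlow2 : (6 : ℝ) ^ ((r - 2) / 2) * (M / 2) * (A.card : ℝ) ^ (r / 2) ≤ I := by
    refine le_trans ?_ hlow
    have e1 : √(6 * A.card) ^ (r - 2) = (6 : ℝ) ^ ((r - 2) / 2) *
        (A.card : ℝ) ^ ((r - 2) / 2) := by
      rw [Real.sqrt_eq_rpow, ← Real.rpow_mul (by positivity),
        Real.mul_rpow (by positivity) (by positivity)]
      congr 2 <;> ring
    have e2 : (A.card : ℝ) ^ (r / 2) = (A.card : ℝ) ^ ((r - 2) / 2) * A.card := by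
      rw [← Real.rpow_add_one hN.ne']
      congr 1
      ring
    rw [e1, e2]
    have : M * A.card / 2 ≤ M * A.card - (6 * (A.card : ℝ))⁻¹ *
        ∫ γ, ‖∑ x ∈ A, evalInv x γ‖ ^ 4 ∂(dualHaar α) := by
      have h5 : (6 * (A.card : ℝ))⁻¹ * ∫ γ, ‖∑ x ∈ A, evalInv x γ‖ ^ 4 ∂(dualHaar α) ≤
          (6 * (A.card : ℝ))⁻¹ * (3 * M * (A.card : ℝ) ^ 2) := by gcongr
      have h6 : (6 * (A.card : ℝ))⁻¹ * (3 * M * (A.card : ℝ) ^ 2) = M * A.card / 2 := by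
        field_simp; norm_num
      linarith
    calc _ = (6 : ℝ) ^ ((r - 2) / 2) * (A.card : ℝ) ^ ((r - 2) / 2) * (M * A.card / 2) := by ring
      _ ≤ _ := by gcongr
  refine absurd ((hn A.card le_rfl).trans_le ?_) (lt_irrefl _)
  calc c * (A.card : ℝ) ^ (1 / 2 : ℝ)
      = a * ((6 : ℝ) ^ ((r - 2) / 2) * (M / 2) * (A.card : ℝ) ^ (r / 2)) ^ (1 / r) := by
        rw [Real.mul_rpow (by positivity) (by positivity), ← Real.rpow_mul hN.le, hc]
        have : r / 2 * (1 / r) = 1 / 2 := by field_simp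
        rw [this, mul_assoc]
    _ ≤ a * I ^ (1 / r) := by gcongr
    _ ≤ K * (a * A.card) ^ P := hup
    _ = K * a ^ P * (A.card : ℝ) ^ P := by
        rw [Real.mul_rpow ha.le hN.le, mul_assoc]

theorem fourierNorm_eq_top_of_inv_add_inv_lt_one [Infinite X] {p q : ℝ≥0∞} (hp : p ≠ 0)
    (hpq : p⁻¹ + q⁻¹ < 1) (hq2 : q⁻¹ < 2⁻¹) : fourierNorm α p q = ∞ := by
  have hreal : p.toReal⁻¹ + q.toReal⁻¹ < 1 := by
    have hp1 : p⁻¹ ≠ ∞ := ((le_self_add).trans_lt (hpq.trans ENNReal.one_lt_top)).ne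
    have hq1 : q⁻¹ ≠ ∞ := ((le_add_self).trans_lt (hpq.trans ENNReal.one_lt_top)).ne
    rw [← ENNReal.toReal_inv, ← ENNReal.toReal_inv, ← ENNReal.toReal_add hp1 hq1]
    exact (ENNReal.toReal_lt_toReal (ENNReal.add_ne_top.2 ⟨hp1, hq1⟩) ENNReal.one_ne_top).2 hpq
  rcases eq_or_ne q ∞ with rfl | hq'
  · by_contra htop
    have hP : p.toReal⁻¹ < 1 := by simpa using hreal
    -- A finite exponent above 2 with `1/r` at most half of `1 - 1/p`, so that `1/p + 1/r < 1`
    -- persists.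
    set r : ℝ := max 3 (2 / (1 - p.toReal⁻¹)) with hr
    have hr3 : 3 ≤ r := le_max_left _ _
    have hrinv : 1 / r ≤ (1 - p.toReal⁻¹) / 2 := by
      rw [one_div_le (by linarith) (by linarith), one_div_div]
      exact le_max_right _ _
    refine fourierNorm_ne_top_of_le α (q' := ENNReal.ofReal r) le_top htop
      (fourierNorm_eq_top_of_two_lt α hp ENNReal.ofReal_ne_top ?_ ?_)
    · rw [ENNReal.toReal_ofReal (by linarith)]; linarith
    · rw [ENNReal.toReal_ofReal (by linarith), one_div p.toReal]; linarith
  · refine fourierNorm_eq_top_of_two_lt α hp hq' ?_ (by simpa using hreal)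
    have := (ENNReal.toReal_lt_toReal (by simp) hq').2 (ENNReal.inv_lt_inv.1 hq2)
    simpa using this

end Unbounded

end LCAFourier

theorem theorem4p1 {X : Type*} [CommGroup X] [TopologicalSpace X] [DiscreteTopology X]
    [Infinite X] [MeasurableSpace X] [BorelSpace X] (α : Measure X) [α.IsHaarMeasure]
    (p q : ℝ≥0∞) (hp : p ≠ 0) (hq : q ≠ 0) :
    (1 ≤ p⁻¹ + q⁻¹ ∧ 2⁻¹ ≤ p⁻¹ →
      LCAFourier.fourierNorm α p q =
        LCAFourier.dualHaar α Set.univ ^ (p⁻¹.toReal + q⁻¹.toReal - 1)) ∧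
    (p⁻¹ + q⁻¹ < 1 ∧ q⁻¹ < 2⁻¹ → LCAFourier.fourierNorm α p q = ∞) ∧
    (p⁻¹ < 2⁻¹ ∧ 2⁻¹ ≤ q⁻¹ → LCAFourier.fourierNorm α p q = ∞) := by
  refine ⟨fun h => LCAFourier.fourierNorm_eq α hp hq h.1 h.2,
    fun h => LCAFourier.fourierNorm_eq_top_of_inv_add_inv_lt_one α hp h.1 h.2,
    fun h => LCAFourier.fourierNorm_eq_top_of_le_two α hp hq (ENNReal.inv_le_inv.1 h.2) ?_⟩
  have := (ENNReal.toReal_lt_toReal (h.1.trans_le le_top).ne (by simp)).2 h.1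
  simpa using this
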